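/- **Setting.** A timed word (trace) over a finite alphabet $\Sigma$ is a finite sequence of events $(\sigma_1,\tau_1)\dots(\sigma_n,\tau_n)\in(\Sigma\times\mathbb R_{\ge 0})^*$ with $\tau_1<\dots<\tau_n$; write $t\in\rho$ if $t$ is a timestamp of $\rho$. A timed automaton over $\Sigma$ has finitely many locations (one initial, some accepting), finitely many clocks, and finitely many transitions $(s,\sigma,g,\lambda,s')$, where the guard $g$ is a conjunction of constraints $x\bowtie c$ with $\bowtie\,\in\{\le,<,\ge,>\}$, $c\in\mathbb N$, and $\lambda$ is the set of clocks reset. It accepts a timed word if it has a run on it that starts in the initial location with all clocks $0$ at time $0$ and ends in an accepting location; $[\![\mathcal A]\!]$ is the set of accepted timed words. It is deterministic if any two distinct transitions with the same source and letter have jointly unsatisfiable guards, and untimed if it has no clocks. HyperMTL formulae over a finite set $\mathrm{AP}$ are generated by $\phi::=\exists\pi\,\phi\mid\forall\pi\,\phi\mid\psi$ and $\psi::=\top\mid\top_\pi\mid p_\pi\mid\psi\wedge\psi\mid\neg\psi\mid\psi\,\mathbf U_I\,\psi\mid\psi\,\mathbf S_I\,\psi$, where $p\in\mathrm{AP}$,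 $\pi$ is a trace variable, no variable is quantified twice, and $I\subseteq\mathbb R_{\ge 0}$ is a non-singular interval with endpoints in $\mathbb N\cup\{\infty\}$. In the asynchronous semantics, for a set $T$ of timed words over $2^{\mathrm{AP}}$, a partial assignment $\Pi$ of traces to trace variables, and $t\ge 0$: $\top$ holds at $t$ iff $t$ is a timestamp of some trace in the range of $\Pi$; $\top_\pi$ holds iff $t\in\Pi(\pi)$; $p_\pi$ holds iff $\Pi(\pi)$ has an event $(\sigma,t)$ with $p\in\sigma$; $\psi_1\,\mathbf U_I\,\psi_2$ holds iff there is $t'>t$ with $t'-t\in I$, $\top$ and $\psi_2$ holding at $t'$, and $\psi_1$ holding at every $t''\in(t,t')$ at which $\top$ holds; $\mathbf S_I$ is the mirror image towards the past; $\wedge$ is as usual; $\neg\psi$ holds iff the negation normal form of $\neg\psi$ does, where negation is pushed inwards through $\wedge$, $\neg$, $\mathbf U_I$, $\mathbf S_I$ by means of the dual operators, $\neg\top$ holds at $t$ iff $\top$ does not, $\neg\top_\pi$ holds iff $t\notin\Pi(\pi)$, and $\neg p_\pi$ holds iff $\Pi(\pi)$ has an event $(\sigma,t)$ with $p\notin\sigma$.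 Trace quantifiers range over $T$. For closed $\phi$, $T\models\phi$ iff $\phi$ holds at time $0$ under the empty assignment. The model-checking problem asks, given a timed automaton $\mathcal A$ over $2^{\mathrm{AP}}$ (the model) and a closed HyperMTL formula $\phi$ over $\mathrm{AP}$ (the specification), whether $[\![\mathcal A]\!]\models\phi$. The fragments $\exists^*\forall^*$ and $\forall^*\exists^*$ consist of the formulae with that quantifier pattern. Call the specification deterministic with $c$ clocks if there is a deterministic timed automaton with $c$ clocks that, for all traces assigned to the quantified variables, accepts their interleaving (the timed word whose timestamps are those of all these traces and whose letter at time $t$ records, for each variable, whether its trace has an event at $t$ and with which label) if and only if the quantifier-free part of the specification holds at time $0$ under this assignment. Call it untimed if all its intervals are $[0,\infty)$. **Theorem.** In the asynchronous semantics, model checking $\exists^*\forall^*$-HyperMTL and model checking $\forall^*\exists^*$-HyperMTL are undecidable. For each of the two fragments this remains so 1. when restricted to instances in which the model is deterministic and untimed and the specification is deterministic with one clock; and also 2. when restricted to instances in which the model is deterministic with one clock and the specification is untimed and deterministic with no clocks. Here undecidability of the problem restricted to a class of instances means that no algorithm (partial recursive function of a standard encoding of instances) halts with the correct answer on every instance in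 the class. -/

import Mathlib

open scoped NNReal

namespace HyperMTL

/-! ### Timed words -/

/-- A timed word (trace) over the alphabet `α`: a finite sequence of events with strictly
increasing non-negative real timestamps. -/
structure TimedWord (α : Type) where
  events : List (α × ℝ≥0)
  increasing : events.Pairwise (fun e e' => e.2 < e'.2)

namespace TimedWord

variable {α : Type}

/-- `t ∈ ρ`: some event of `ρ` has timestamp `t`. -/
def HasTime (ρ : TimedWord α) (t : ℝ≥0) : Prop := ∃ a, (a, t) ∈ ρ.events

/-- The set of timestamps of `ρ`. -/
noncomputable def times (ρ : TimedWord α) : Finset ℝ≥0 := (ρ.events.map Prod.snd).toFinset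

/-- The letter of the event of `ρ` at time `t`, if there is such an event. -/
noncomputable def letterAt (ρ : TimedWord α) (t : ℝ≥0) : Option α :=
  (ρ.events.find? (fun e => decide (e.2 = t))).map Prod.fst

/-- The interleaving of a finite family of timed words: its timestamps are those of all the words
of the family, and the letter at time `t` tells, for each index `i`, whether the `i`-th word has
an event at `t`, and if so with which letter. -/
noncomputable def interleave {ι : Type} [Fintype ι] (ρ : ι → TimedWord α) :
    TimedWord (ι → Option α) where
  events := ((Finset.univ.biUnion fun i => (ρ i).times).sort (· ≤ ·)).map
    fun t => (fun i => (ρ i).letterAt t, t)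
  increasing := by
    rw [List.pairwise_map]
    exact (Finset.sortedLT_sort _).pairwise

end TimedWord

/-! ### Timed automata -/

/-- Comparison symbols. -/
inductive Cmp
  | le | lt | ge | gt

def Cmp.Holds : Cmp → ℝ≥0 → ℕ → Prop
  | .le, x, c => x ≤ c
  | .lt, x, c => x < c
  | .ge, x, c => x ≥ c
  | .gt, x, c => x > c

/-- Clock constraints over the clocks `X`. -/
inductive Guard (X : Type)
  | top : Guard X
  | and : Guard X → Guard X → Guard X
  | cmp : X → Cmp → ℕ → Guard X

def Guard.Sat {X : Type} (v : X → ℝ≥0) : Guard X → Prop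
  | .top => True
  | .and g h => g.Sat v ∧ h.Sat v
  | .cmp x r c => r.Holds (v x) c

/-- A transition: source, letter, guard, set of clocks to be reset, target. -/
structure Transition (α S X : Type) where
  src : S
  letter : α
  guard : Guard X
  reset : Finset X
  tgt : S

/-- A timed automaton over the alphabet `α` with locations `S` and clocks `X`. The finite
transition relation and the finite set of accepting locations are given by lists, of which only
the membership relation matters. -/
structure TimedAutomaton (α S X : Type) where
  init : S
  trans : List (Transition α S X)
  final : List S

namespace TimedAutomaton

variable {α S X : Type}

/-- Two distinct transitions with the same source and letter have incompatible guards. -/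
def Deterministic (A : TimedAutomaton α S X) : Prop :=
  ∀ d ∈ A.trans, ∀ e ∈ A.trans, d ≠ e → d.src = e.src → d.letter = e.letter →
    ¬ ∃ v : X → ℝ≥0, d.guard.Sat v ∧ e.guard.Sat v

open Classical in
/-- `v[r ← 0]` -/
noncomputable def resetClocks (r : Finset X) (v : X → ℝ≥0) : X → ℝ≥0 :=
  fun x => if x ∈ r then 0 else v x

/-- `Run A s v τ w s' v'`: starting in state `(s, v)` at time `τ`, the automaton has a run on the
sequence of events `w` that ends in state `(s', v')`. -/
inductive Run (A : TimedAutomaton α S X) :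
    S → (X → ℝ≥0) → ℝ≥0 → List (α × ℝ≥0) → S → (X → ℝ≥0) → Prop
  | nil (s : S) (v : X → ℝ≥0) (τ : ℝ≥0) : Run A s v τ [] s v
  | cons (d : Transition α S X) (v : X → ℝ≥0) (τ τ' : ℝ≥0) (w : List (α × ℝ≥0))
      (s' : S) (v' : X → ℝ≥0) (hd : d ∈ A.trans)
      (hg : d.guard.Sat (fun x => v x + (τ' - τ)))
      (hr : Run A d.tgt (resetClocks d.reset (fun x => v x + (τ' - τ))) τ' w s' v') :
      Run A d.src v τ ((d.letter, τ') :: w) s' v'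

def Accepts (A : TimedAutomaton α S X) (ρ : TimedWord α) : Prop :=
  ∃ s v, A.Run A.init (fun _ => 0) 0 ρ.events s v ∧ s ∈ A.final

/-- The timed language of `A`. -/
def language (A : TimedAutomaton α S X) : Set (TimedWord α) := {ρ | A.Accepts ρ}

end TimedAutomaton

/-! ### HyperMTL -/

/-- Non-singular intervals with endpoints in `ℕ ∪ {∞}`. The Booleans tell whether the endpoint
belongs to the interval; `hi = none` stands for the right endpoint `∞`. -/
structure Interval where
  lo : ℕ
  loClosed : Bool
  hi : Option (ℕ × Bool)
  nonsingular : ∀ b ∈ hi, lo < b.1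

/-- `d` belongs to the interval. -/
def Interval.Contains (I : Interval) (d : ℝ≥0) : Prop :=
  (if I.loClosed then (I.lo : ℝ≥0) ≤ d else (I.lo : ℝ≥0) < d) ∧
    ∀ b ∈ I.hi, if b.2 then d ≤ (b.1 : ℝ≥0) else d < (b.1 : ℝ≥0)

/-- The interval `[0, ∞)`. -/
def Interval.univ : Interval := ⟨0, true, none, by simp⟩

/-- Quantifier-free HyperMTL formulae over the atomic propositions `P`. Trace variables are
natural numbers. -/
inductive QF (P : Type)
  | top : QF P
  | topAt : ℕ → QF P
  | atom : P → ℕ → QF P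
  | and : QF P → QF P → QF P
  | neg : QF P → QF P
  | untl : Interval → QF P → QF P → QF P
  | since : Interval → QF P → QF P → QF P

/-- HyperMTL formulae over the atomic propositions `P`. -/
inductive Formula (P : Type)
  | ex : ℕ → Formula P → Formula P
  | all : ℕ → Formula P → Formula P
  | qf : QF P → Formula P

/-- Trace assignments over `Σ_P = 2^P`: partial maps from trace variables to traces. -/
abbrev Assignment (P : Type) := ℕ → Option (TimedWord (Finset P))

/-- Some trace in the range of the assignment has an event at time `t`. -/
def Assignment.Active {P : Type} (a : Assignment P) (t : ℝ≥0) : Prop :=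
  ∃ π, ∃ ρ ∈ a π, ρ.HasTime t

namespace QF

variable {P : Type}

/-- The pointwise semantics. `Holds a true ψ t` says that `ψ` is satisfied at time `t` under the
assignment `a`; `Holds a false ψ t` says that the negative normal form of `¬ψ` is: negation is
pushed inwards through the dual operators, `¬⊤` holds where no trace has an event, `¬⊤_π` holds
where the trace `π` has no event, and `¬p_π` holds where the trace `π` has an event whose label
does not contain `p`. -/
def Holds (a : Assignment P) : Bool → QF P → ℝ≥0 → Prop
  | true, .top, t => a.Active t
  | false, .top, t => ¬ a.Active t
  | true, .topAt π, t => ∃ ρ ∈ a π, ρ.HasTime t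
  | false, .topAt π, t => ¬ ∃ ρ ∈ a π, ρ.HasTime t
  | true, .atom p π, t => ∃ ρ ∈ a π, ∃ σ, (σ, t) ∈ ρ.events ∧ p ∈ σ
  | false, .atom p π, t => ∃ ρ ∈ a π, ∃ σ, (σ, t) ∈ ρ.events ∧ p ∉ σ
  | true, .and ψ χ, t => Holds a true ψ t ∧ Holds a true χ t
  | false, .and ψ χ, t => Holds a false ψ t ∨ Holds a false χ t
  | true, .neg ψ, t => Holds a false ψ t
  | false, .neg ψ, t => Holds a true ψ t
  | true, .untl I ψ χ, t => ∃ t', t < t' ∧ I.Contains (t' - t) ∧ a.Active t' ∧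
      Holds a true χ t' ∧ ∀ t'', t < t'' → t'' < t' → a.Active t'' → Holds a true ψ t''
  | false, .untl I ψ χ, t => ∀ t', t < t' → I.Contains (t' - t) → a.Active t' →
      Holds a false χ t' ∨ ∃ t'', t < t'' ∧ t'' < t' ∧ a.Active t'' ∧ Holds a false ψ t''
  | true, .since I ψ χ, t => ∃ t', t' < t ∧ I.Contains (t - t') ∧ a.Active t' ∧
      Holds a true χ t' ∧ ∀ t'', t' < t'' → t'' < t → a.Active t'' → Holds a true ψ t''
  | false, .since I ψ χ, t => ∀ t', t' < t → I.Contains (t - t') → a.Active t' →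
      Holds a false χ t' ∨ ∃ t'', t' < t'' ∧ t'' < t ∧ a.Active t'' ∧ Holds a false ψ t''

/-- The trace variables that occur in the formula. -/
def vars : QF P → Finset ℕ
  | .top => ∅
  | .topAt π => {π}
  | .atom _ π => {π}
  | .and ψ χ => ψ.vars ∪ χ.vars
  | .neg ψ => ψ.vars
  | .untl _ ψ χ => ψ.vars ∪ χ.vars
  | .since _ ψ χ => ψ.vars ∪ χ.vars

/-- All constraining intervals are `[0, ∞)`. -/
def Untimed : QF P → Prop
  | .top => True
  | .topAt _ => True
  | .atom _ _ => True
  | .and ψ χ => ψ.Untimed ∧ χ.Untimed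
  | .neg ψ => ψ.Untimed
  | .untl I ψ χ => I = Interval.univ ∧ ψ.Untimed ∧ χ.Untimed
  | .since I ψ χ => I = Interval.univ ∧ ψ.Untimed ∧ χ.Untimed

end QF

namespace Formula

variable {P : Type}

/-- The asynchronous semantics of HyperMTL over the trace set `T`. -/
def Holds (T : Set (TimedWord (Finset P))) : Assignment P → Formula P → ℝ≥0 → Prop
  | a, .ex π φ, t => ∃ ρ ∈ T, Holds T (Function.update a π (some ρ)) φ t
  | a, .all π φ, t => ∀ ρ ∈ T, Holds T (Function.update a π (some ρ)) φ t
  | a, .qf ψ, t => ψ.Holds a true t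

/-- `T ⊨ φ` -/
def Satisfies (T : Set (TimedWord (Finset P))) (φ : Formula P) : Prop :=
  Holds T (fun _ => none) φ 0

/-- The quantified trace variables, outermost first. -/
def boundVars : Formula P → List ℕ
  | .ex π φ => π :: φ.boundVars
  | .all π φ => π :: φ.boundVars
  | .qf _ => []

def freeVars : Formula P → Finset ℕ
  | .ex π φ => φ.freeVars.erase π
  | .all π φ => φ.freeVars.erase π
  | .qf ψ => ψ.vars

/-- The quantifier-free part. -/
def body : Formula P → QF P
  | .ex _ φ => φ.body
  | .all _ φ => φ.body
  | .qf ψ => ψ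

/-- Quantifier pattern `∃*`. -/
def IsExists : Formula P → Prop
  | .ex _ φ => φ.IsExists
  | .all _ _ => False
  | .qf _ => True

/-- Quantifier pattern `∀*`. -/
def IsForall : Formula P → Prop
  | .ex _ _ => False
  | .all _ φ => φ.IsForall
  | .qf _ => True

/-- Quantifier pattern `∃*∀*`. -/
def IsExistsForall : Formula P → Prop
  | .ex _ φ => φ.IsExistsForall
  | .all _ φ => φ.IsForall
  | .qf _ => True

/-- Quantifier pattern `∀*∃*`. -/
def IsForallExists : Formula P → Prop
  | .ex _ φ => φ.IsExists
  | .all _ φ => φ.IsForallExists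
  | .qf _ => True

/-- The variables of the quantifier prefix, as a finite index set. -/
abbrev Var (φ : Formula P) : Type := {π : ℕ // π ∈ φ.boundVars.toFinset}

/-- The trace assignment whose domain is the set of variables of the quantifier prefix and which
maps each such variable to the given trace. -/
def assign (φ : Formula P) (ρ : φ.Var → TimedWord (Finset P)) : Assignment P :=
  fun π => if h : π ∈ φ.boundVars.toFinset then some (ρ ⟨π, h⟩) else none

/-- The quantifier-free part of `φ` translates into a deterministic timed automaton with `c`
clocks: some such automaton, reading the interleaving of the traces assigned to the quantified
variables, accepts exactly when these traces satisfy the quantifier-free part. -/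
def IsDeterministic (c : ℕ) (φ : Formula P) : Prop :=
  ∃ (S : Type) (_ : Finite S)
    (B : TimedAutomaton (φ.Var → Option (Finset P)) S (Fin c)),
    B.Deterministic ∧
      ∀ ρ : φ.Var → TimedWord (Finset P),
        B.Accepts (TimedWord.interleave ρ) ↔ φ.body.Holds (φ.assign ρ) true 0

/-- All constraining intervals in `φ` are `[0, ∞)`. -/
def Untimed (φ : Formula P) : Prop := φ.body.Untimed

end Formula

/-! ### The model-checking problem -/

/-- An instance of the model-checking problem: a timed automaton over `Σ_AP` and a closed HyperMTL
formula over `AP` in which no trace variable is quantified twice. Atomic propositions, locations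
and clocks are numbered. -/
structure Instance where
  nProps : ℕ
  nLocs : ℕ
  nClocks : ℕ
  model : TimedAutomaton (Finset (Fin nProps)) (Fin nLocs) (Fin nClocks)
  spec : Formula (Fin nProps)
  closed : spec.freeVars = ∅
  fresh : spec.boundVars.Nodup

/-- The question asked: does the timed language of the model satisfy the specification (in the
asynchronous semantics)? -/
def Instance.Yes (I : Instance) : Prop := I.spec.Satisfies I.model.language

/-! ### Instances as inputs of algorithms -/

def Cmp.code : Cmp → ℕ
  | .le => 0
  | .lt => 1
  | .ge => 2
  | .gt => 3

def finsetCode {n : ℕ} (s : Finset (Fin n)) : List ℕ := (s.sort (· ≤ ·)).map Fin.val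

def Guard.code {n : ℕ} : Guard (Fin n) → ℕ
  | .top => Nat.pair 0 0
  | .and g h => Nat.pair 1 (Nat.pair g.code h.code)
  | .cmp x r c => Nat.pair 2 (Nat.pair x (Nat.pair r.code c))

def Transition.code {n m c : ℕ} (d : Transition (Finset (Fin n)) (Fin m) (Fin c)) :
    ℕ × List ℕ × ℕ × List ℕ × ℕ :=
  (d.src, finsetCode d.letter, d.guard.code, finsetCode d.reset, d.tgt)

def TimedAutomaton.code {n m c : ℕ} (A : TimedAutomaton (Finset (Fin n)) (Fin m) (Fin c)) :
    ℕ × List (ℕ × List ℕ × ℕ × List ℕ × ℕ) × List ℕ :=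
  (A.init, A.trans.map Transition.code, A.final.map Fin.val)

def Interval.code (I : Interval) : ℕ := Encodable.encode (I.lo, I.loClosed, I.hi)

def QF.code {n : ℕ} : QF (Fin n) → ℕ
  | .top => Nat.pair 0 0
  | .topAt π => Nat.pair 1 π
  | .atom p π => Nat.pair 2 (Nat.pair p π)
  | .and ψ χ => Nat.pair 3 (Nat.pair ψ.code χ.code)
  | .neg ψ => Nat.pair 4 ψ.code
  | .untl I ψ χ => Nat.pair 5 (Nat.pair I.code (Nat.pair ψ.code χ.code))
  | .since I ψ χ => Nat.pair 6 (Nat.pair I.code (Nat.pair ψ.code χ.code))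

def Formula.code {n : ℕ} : Formula (Fin n) → ℕ
  | .ex π φ => Nat.pair 0 (Nat.pair π φ.code)
  | .all π φ => Nat.pair 1 (Nat.pair π φ.code)
  | .qf ψ => Nat.pair 2 ψ.code

/-- The natural number by which an instance is presented to an algorithm. -/
def Instance.code (I : Instance) : ℕ :=
  Encodable.encode ((I.nProps, I.nLocs, I.nClocks), I.model.code, I.spec.code)

/-- The model-checking problem, restricted to the instances in `K`, is undecidable: no algorithm
(partial recursive function on codes) halts with the correct answer on all instances in `K`. -/
def Undecidable (K : Set Instance) : Prop :=
  ¬ ∃ f : ℕ →. Bool, Partrec f ∧ ∀ I ∈ K, ∃ b ∈ f I.code, (b = true ↔ I.Yes)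

/-! ### Distinct instances have distinct codes -/

theorem Cmp.code_injective : Function.Injective Cmp.code := by
  intro a b h
  cases a <;> cases b <;> simp_all [Cmp.code]

theorem finsetCode_injective {n : ℕ} : Function.Injective (finsetCode (n := n)) := by
  intro s t h
  have h2 := (List.map_injective_iff.2 Fin.val_injective) h
  rw [← Finset.sort_toFinset (r := (· ≤ ·)) s, h2, Finset.sort_toFinset]

theorem Guard.code_injective {n : ℕ} : Function.Injective (Guard.code (n := n)) := by
  intro g
  induction g with
  | top => intro h e; cases h <;> simp_all [Guard.code, Nat.pair_eq_pair]
  | and g1 g2 ih1 ih2 =>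
    intro h e
    cases h <;> simp [Guard.code, Nat.pair_eq_pair] at e
    simp [ih1 e.1, ih2 e.2]
  | cmp x r c =>
    intro h e
    cases h <;> simp [Guard.code, Nat.pair_eq_pair] at e
    simp [Fin.ext e.1, Cmp.code_injective e.2.1, e.2.2]

theorem Transition.code_injective {n m c : ℕ} :
    Function.Injective (Transition.code (n := n) (m := m) (c := c)) := by
  rintro ⟨s, a, g, r, t⟩ ⟨s2, a2, g2, r2, t2⟩ h
  simp only [Transition.code, Prod.mk.injEq] at h
  obtain ⟨h1, h2, h3, h4, h5⟩ := h
  simp [Fin.ext h1, finsetCode_injective h2, Guard.code_injective h3, finsetCode_injective h4,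
    Fin.ext h5]

theorem TimedAutomaton.code_injective {n m c : ℕ} :
    Function.Injective (TimedAutomaton.code (n := n) (m := m) (c := c)) := by
  rintro ⟨s, d, f⟩ ⟨s2, d2, f2⟩ h
  simp only [TimedAutomaton.code, Prod.mk.injEq] at h
  obtain ⟨h1, h2, h3⟩ := h
  simp [Fin.ext h1, (List.map_injective_iff.2 Transition.code_injective) h2,
    (List.map_injective_iff.2 Fin.val_injective) h3]

theorem Interval.code_injective : Function.Injective Interval.code := by
  rintro ⟨a, b, c, h⟩ ⟨a2, b2, c2, h2⟩ e
  have e2 := Encodable.encode_injective e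
  simp only [Prod.mk.injEq] at e2
  obtain ⟨rfl, rfl, rfl⟩ := e2
  rfl

theorem QF.code_injective {n : ℕ} : Function.Injective (QF.code (n := n)) := by
  intro g
  induction g with
  | top => intro h e; cases h <;> simp_all [QF.code, Nat.pair_eq_pair]
  | topAt π => intro h e; cases h <;> simp_all [QF.code, Nat.pair_eq_pair]
  | atom p π =>
    intro h e
    cases h <;> simp [QF.code, Nat.pair_eq_pair] at e
    simp [Fin.ext e.1, e.2]
  | and g1 g2 ih1 ih2 =>
    intro h e
    cases h <;> simp [QF.code, Nat.pair_eq_pair] at e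
    simp [ih1 e.1, ih2 e.2]
  | neg g1 ih1 =>
    intro h e
    cases h <;> simp [QF.code, Nat.pair_eq_pair] at e
    simp [ih1 e]
  | untl I g1 g2 ih1 ih2 =>
    intro h e
    cases h <;> simp [QF.code, Nat.pair_eq_pair] at e
    simp [Interval.code_injective e.1, ih1 e.2.1, ih2 e.2.2]
  | since I g1 g2 ih1 ih2 =>
    intro h e
    cases h <;> simp [QF.code, Nat.pair_eq_pair] at e
    simp [Interval.code_injective e.1, ih1 e.2.1, ih2 e.2.2]

theorem Formula.code_injective {n : ℕ} : Function.Injective (Formula.code (n := n)) := by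
  intro g
  induction g with
  | ex π g1 ih1 =>
    intro h e
    cases h <;> simp [Formula.code, Nat.pair_eq_pair] at e
    simp [e.1, ih1 e.2]
  | all π g1 ih1 =>
    intro h e
    cases h <;> simp [Formula.code, Nat.pair_eq_pair] at e
    simp [e.1, ih1 e.2]
  | qf ψ =>
    intro h e
    cases h <;> simp [Formula.code, Nat.pair_eq_pair] at e
    simp [QF.code_injective e]

theorem Instance.code_injective : Function.Injective Instance.code := by
  rintro ⟨n, m, c, A, φ, _, _⟩ ⟨n2, m2, c2, A2, φ2, _, _⟩ h
  have e := Encodable.encode_injective h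
  simp only [Prod.mk.injEq] at e
  obtain ⟨⟨rfl, rfl, rfl⟩, e1, e2⟩ := e
  obtain rfl := TimedAutomaton.code_injective e1
  obtain rfl := Formula.code_injective e2
  rfl

end HyperMTL

/-!
The halting problem of a fixed Turing machine on input `n` is reduced to model checking a formula
`∃ 0 ∀ 1 ψ`, and its complement to `∀ 0 ∃ 1 ¬ψ`, where only `ψ` depends on `n`
(`exists_machine_undecidable_halting`, `undecidable_of_timeDistance`).

The trace `0` is to describe a halting computation. Its configurations, separated by walls, are
written one after the other with the same number `N` of cells, and each event shows a cell together
with its two neighbours (`IsHelix`). Such a word is correct if consecutive tiles fit, the initial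
configuration is right, and each tile fits the one that comes `N` events later. The computation
takes place in a space that is fixed in advance, because a tile is rejected if the head leaves it
towards a wall; a halting computation needs only finite space (`IsHelix.dom`, `exists_isHelix`).

The number `N` is not known to the formula. Instead, the word is spread over time so that `N` events
later means one time unit later, and the trace `1` probes it: its first two events are marks at
times `s` and `s + 1`. As `s` ranges over all times, the formula checks that the events at the two
marks fit, that an event at `s` has a counterpart at `s + 1` unless the word has ended by then, and
that an event at `s + 1` has a counterpart at `s` unless the word begins later than that. It follows
by induction that the `k`-th and the `(k + N)`-th event are one time unit apart, where `N` is the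
number of events in the first time unit (`dom_of_markOK`). Since time is dense, the formula cannot
measure the distances of all events of the trace `0` with finitely many clocks, but one
clock suffices for the only two marks. This clock may belong to the automaton of the specification
(`TimeDistance.bySpec`) or to the model, which then requires that every event with a certain
proposition `d` happen one time unit after the previous one (`TimeDistance.byModel`). In the latter
case the formula just trusts the marks with `d` and is untimed. A second trace without proper marks
is ignored. The model is one for both traces, so it also accepts the words without `d`.

Everything the formula says about the two traces is that some event satisfies one past formula
and no event satisfies another (`specBody`), where the past formulas use `S` with the interval
`[0, ∞)` only, besides an atomic formula `dist` for the distance of the marks. The truth values of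
past formulas can be updated event by event with finite memory, which makes the specification
deterministic (`Past.tracked`, `exists_timedAutomaton_of_past`). Negation in HyperMTL is not
complementation, since both `p_π` and `¬p_π` fail where the trace `π` has no event; only
combinations for which it is are used (`QF.Exact`).
-/

namespace HyperMTL

open Turing StateTransition

/-! ### A fixed machine with an undecidable halting problem -/

/-- The binary increment on lists of digits, least significant digit first. -/
def binInc : List Bool → List Bool
  | [] => [true]
  | false :: l => true :: l
  | true :: l => false :: binInc l

/-- The binary digits of `n`, least significant digit first. -/
def binDigits : ℕ → List Bool
  | 0 => []
  | n + 1 => binInc (binDigits n)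

theorem primrec_binInc : Primrec binInc := by
  have h : Primrec fun l : List Bool => (List.recOn l [true] fun b t IH =>
      (cond b (false :: IH) (true :: t) : List Bool) : List Bool) :=
    Primrec.list_rec Primrec.id (Primrec.const [true])
      (Primrec.cond (Primrec.fst.comp Primrec.snd)
        (Primrec.list_cons.comp (Primrec.const false)
          (Primrec.snd.comp (Primrec.snd.comp Primrec.snd)))
        (Primrec.list_cons.comp (Primrec.const true)
          (Primrec.fst.comp (Primrec.snd.comp Primrec.snd)))).to₂
  refine h.of_eq fun l => ?_
  induction l with
  | nil => rfl
  | cons b t ih => cases b <;> simp_all [binInc]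

theorem primrec_binDigits : Primrec binDigits := by
  have h : Primrec fun n : ℕ => (Nat.rec [] (fun _ IH => binInc IH) n : List Bool) :=
    Primrec.nat_rec₁ [] ((primrec_binInc.comp Primrec.snd).to₂)
  refine h.of_eq fun n => ?_
  induction n with
  | zero => rfl
  | succ n ih => simp_all [binDigits]

/-- The stack symbol by which `Turing.PartrecToTM2` represents a binary digit. -/
def digitSymbol (b : Bool) : PartrecToTM2.Γ' :=
  cond b PartrecToTM2.Γ'.bit1 PartrecToTM2.Γ'.bit0

theorem exists_binInc_trPosNum (p : PosNum) :
    ∃ l, PartrecToTM2.trPosNum p = l.map digitSymbol ∧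
      PartrecToTM2.trPosNum p.succ = (binInc l).map digitSymbol := by
  induction p with
  | one => exact ⟨[true], rfl, rfl⟩
  | bit1 p ih =>
    obtain ⟨l, h1, h2⟩ := ih
    exact ⟨true :: l, by simp [PartrecToTM2.trPosNum, h1, digitSymbol],
      by simp [PartrecToTM2.trPosNum, PosNum.succ, h2, digitSymbol, binInc]⟩
  | bit0 p ih =>
    obtain ⟨l, h1, h2⟩ := ih
    exact ⟨false :: l, by simp [PartrecToTM2.trPosNum, h1, digitSymbol],
      by simp [PartrecToTM2.trPosNum, PosNum.succ, h1, digitSymbol, binInc]⟩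

theorem trNat_eq_binDigits (n : ℕ) :
    PartrecToTM2.trNat n = (binDigits n).map digitSymbol := by
  induction n with
  | zero => simp [binDigits]
  | succ n ih =>
    have hinj : Function.Injective digitSymbol := by
      intro a b; cases a <;> cases b <;> simp [digitSymbol]
    simp only [PartrecToTM2.trNat, Nat.cast_succ, Num.add_one] at ih ⊢
    cases h : (n : Num) with
    | zero =>
      rw [h] at ih
      have : binDigits n = [] := by simpa [PartrecToTM2.trNum] using ih.symm
      simp [binDigits, this, binInc, digitSymbol, Num.succ, Num.succ', PartrecToTM2.trNum,
        PartrecToTM2.trPosNum]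
    | pos p =>
      rw [h] at ih
      obtain ⟨l, h1, h2⟩ := exists_binInc_trPosNum p
      have : l = binDigits n := List.map_injective_iff.2 hinj (h1.symm.trans ih)
      simpa [binDigits, this, Num.succ, Num.succ', PartrecToTM2.trNum] using h2

/-- Some partial recursive function on the natural numbers has an undecidable domain. -/
theorem exists_partrec_undecidable_dom :
    ∃ f : ℕ →. ℕ, Partrec f ∧ ¬ ComputablePred fun n => (f n).Dom := by
  refine ⟨fun n => Nat.Partrec.Code.eval (Denumerable.ofNat _ n) 0,
    Nat.Partrec.Code.eval_part.comp (Computable.ofNat _) (Computable.const 0), fun h => ?_⟩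
  refine ComputablePred.halting_problem 0 ?_
  obtain ⟨d, hd, h⟩ := ComputablePred.computable_iff.1 h
  refine ComputablePred.computable_iff.2
    ⟨fun c => d (Encodable.encode c), hd.comp Computable.encode, funext fun c => ?_⟩
  simpa [Denumerable.ofNat_encode] using congrFun h (Encodable.encode c)

/-- A Turing machine with finitely many states whose halting problem, for inputs consisting of
a fixed symbol followed by the binary digits of a number, is undecidable. -/
theorem exists_machine_undecidable_halting :
    ∃ (Γ Λ : Type) (_ : Inhabited Γ) (_ : Inhabited Λ) (_ : Finite Γ) (_ : Finite Λ)
      (M : TM0.Machine Γ Λ) (a₀ : Γ) (g : Bool → Γ),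
      ¬ ComputablePred fun n : ℕ => (eval (TM0.step M)
        (TM0.init (a₀ :: (binDigits n).reverse.map g))).Dom := by
  obtain ⟨f, hf, hdom⟩ := exists_partrec_undecidable_dom
  obtain ⟨c, hc⟩ := ToPartrec.Code.exists_code (Nat.Partrec'.part_iff₁.2 hf)
  -- `f` is computed by a machine with stacks, which is simulated by a machine with one tape; both
  -- have infinitely many states, of which only a finite set is reachable.
  let _ : Inhabited PartrecToTM2.Λ' := ⟨PartrecToTM2.trNormal c PartrecToTM2.Cont'.halt⟩
  have hsupp := PartrecToTM2.tr_supports c PartrecToTM2.Cont'.halt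
  have hsupp1 := TM2to1.tr_supports (M := PartrecToTM2.tr) hsupp
  have hsupp0 := TM1to0.tr_supports _ hsupp1
  set M₁ := TM2to1.tr PartrecToTM2.tr with hM₁
  set S := TM1to0.trStmts M₁ (TM2to1.trSupp PartrecToTM2.tr
    (PartrecToTM2.codeSupp c PartrecToTM2.Cont'.halt)) with hS
  have : Fintype PartrecToTM2.K' :=
    ⟨⟨{.main, .rev, .aux, .stack}, by simp⟩, fun k => by cases k <;> simp⟩
  classical
  let _ : Inhabited S := ⟨⟨default, hsupp0.1⟩⟩
  -- `M` is the simulating machine, restricted to the reachable states.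
  let g₁ : PointedMap (TM1to0.Λ' M₁) S :=
    ⟨fun q => if h : q ∈ S then ⟨q, h⟩ else default, dif_pos hsupp0.1⟩
  let M := (TM1to0.tr M₁).map ⟨id, rfl⟩ ⟨id, rfl⟩ g₁ (fun q : S => q.1)
  have hresp := TM0.Machine.map_respects (TM1to0.tr M₁) ⟨id, rfl⟩ ⟨id, rfl⟩ g₁ (fun q : S => q.1)
    hsupp0 (fun _ => rfl) (fun q hq => by simp [g₁, Finset.mem_coe.1 hq])
  -- The tape symbol that carries `o` on the stack for input and nothing on the other stacks.
  let G : Option PartrecToTM2.Γ' → TM2to1.Γ' PartrecToTM2.K' (fun _ => PartrecToTM2.Γ') :=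
    fun o => (false, Function.update (fun _ => none) PartrecToTM2.K'.main o)
  refine ⟨TM2to1.Γ' PartrecToTM2.K' (fun _ => PartrecToTM2.Γ'), S, inferInstance, inferInstance,
    inferInstance, inferInstance, M, (true, (G (some .cons)).2),
    fun b => G (some (digitSymbol b)), ?_⟩
  have key : ∀ n, (eval (TM0.step M) (TM0.init ((true, (G (some .cons)).2) ::
      (binDigits n).reverse.map fun b => G (some (digitSymbol b))))).Dom ↔ (f n).Dom := by
    intro n
    set l : List (TM2to1.Γ' PartrecToTM2.K' (fun _ => PartrecToTM2.Γ')) :=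
      (true, (G (some .cons)).2) ::
      (binDigits n).reverse.map fun b => G (some (digitSymbol b)) with hl
    have e1 : TM2to1.trInit PartrecToTM2.K'.main (PartrecToTM2.trList [n]) = l := by
      have hr : (PartrecToTM2.trList [n]).reverse =
          PartrecToTM2.Γ'.cons :: (binDigits n).reverse.map digitSymbol := by
        simp [PartrecToTM2.trList, trNat_eq_binDigits]
      rw [TM2to1.trInit, hr]
      exact congrArg (List.cons _) List.map_map
    have e2 : TM2.init PartrecToTM2.K'.main (PartrecToTM2.trList [n]) =
        PartrecToTM2.init c [n] := by
      simp only [TM2.init, PartrecToTM2.init]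
      congr 1
      funext k
      cases k <;> simp [PartrecToTM2.K'.elim, Function.update]
    rw [show (f n).Dom ↔ (ToPartrec.Code.eval c [n]).Dom by
      have := hc ⟨[n], rfl⟩
      simp only at this
      rw [this]
      rfl]
    have h1 : (eval (TM0.step M) (TM0.init l)).Dom ↔
        (eval (TM0.step (TM1to0.tr M₁)) (TM0.init l)).Dom := by
      refine tr_eval_dom hresp ⟨hsupp0.1, ?_⟩
      rw [TM0.map_init]
      congr 1
      exact List.map_id l
    have h2 : (eval (TM0.step (TM1to0.tr M₁)) (TM0.init l)).Dom ↔ (TM1.eval M₁ l).Dom := by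
      rw [← TM1to0.tr_eval]
      rfl
    have h3 := TM2to1.tr_eval_dom PartrecToTM2.tr PartrecToTM2.K'.main (PartrecToTM2.trList [n])
    rw [e1] at h3
    rw [h1, h2, h3]
    change (eval (TM2.step PartrecToTM2.tr) (TM2.init _ _)).Dom ↔ _
    rw [e2]
    have := PartrecToTM2.tr_eval c [n]
    exact Iff.of_eq (congrArg Part.Dom this)
  intro h
  exact hdom (by simpa only [key] using h)

/-! ### Timed automata given by a step function -/

namespace TimedAutomaton

variable {α S X : Type}

theorem run_nil_iff {A : TimedAutomaton α S X} {s s' : S} {v v' : X → ℝ≥0} {τ : ℝ≥0} :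
    A.Run s v τ [] s' v' ↔ s' = s ∧ v' = v := by
  constructor
  · intro h; cases h; exact ⟨rfl, rfl⟩
  · rintro ⟨rfl, rfl⟩; exact .nil _ _ _

theorem run_cons_iff {A : TimedAutomaton α S X} {s s' : S} {v v' : X → ℝ≥0} {τ τ' : ℝ≥0} {a : α}
    {w : List (α × ℝ≥0)} :
    A.Run s v τ ((a, τ') :: w) s' v' ↔ ∃ d ∈ A.trans, d.src = s ∧ d.letter = a ∧
      d.guard.Sat (fun x => v x + (τ' - τ)) ∧
      A.Run d.tgt (resetClocks d.reset (fun x => v x + (τ' - τ))) τ' w s' v' := by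
  constructor
  · intro h
    cases h with
    | cons d _ _ _ _ _ _ hd hg hr => exact ⟨d, hd, rfl, rfl, hg, hr⟩
  · rintro ⟨d, hd, rfl, rfl, hg, hr⟩
    exact .cons d _ _ _ _ _ _ hd hg hr

end TimedAutomaton

/-- The guard `x = 1`, `x < 1` or `x > 1`. -/
def Guard.compareOne {X : Type} (x : X) : Ordering → Guard X
  | .lt => .cmp x .lt 1
  | .eq => .and (.cmp x .le 1) (.cmp x .ge 1)
  | .gt => .cmp x .gt 1

theorem Guard.sat_compareOne {X : Type} (v : X → ℝ≥0) (x : X) (o : Ordering) :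
    (Guard.compareOne x o).Sat v ↔ _root_.cmp (v x) 1 = o := by
  cases o <;> simp [compareOne, Sat, Cmp.Holds, cmp_eq_lt_iff, cmp_eq_gt_iff, cmp_eq_eq_iff,
    le_antisymm_iff]

/-- The guard that fixes how each of the clocks compares with `1`. -/
def Guard.compareOnes {c : ℕ} (o : Fin c → Ordering) : Guard (Fin c) :=
  (List.finRange c).foldr (fun x g => .and (.compareOne x (o x)) g) .top

theorem Guard.sat_compareOnes {c : ℕ} (v : Fin c → ℝ≥0) (o : Fin c → Ordering) :
    (Guard.compareOnes o).Sat v ↔ (fun x => _root_.cmp (v x) 1) = o := by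
  have h : ∀ l : List (Fin c), (l.foldr (fun x g => Guard.and (.compareOne x (o x)) g) .top).Sat v ↔
      ∀ x ∈ l, _root_.cmp (v x) 1 = o x := by
    intro l
    induction l with
    | nil => simp [Sat]
    | cons x l ih => simp [Sat, ih, sat_compareOne]
  rw [compareOnes, h, funext_iff]
  simp

/-- A deterministic automaton with `c` clocks presented by a step function, which reads a letter
and how the clocks compare with `1`, and returns the next state and the clocks to be reset. -/
structure StepAutomaton (α S : Type) (c : ℕ) where
  init : S
  step : S → α → (Fin c → Ordering) → S × Finset (Fin c)
  accept : S → Prop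

namespace StepAutomaton

variable {α S : Type} {c : ℕ} (A : StepAutomaton α S c)

/-- The effect of an event on a configuration: location, clock valuation and current time. -/
noncomputable def next (q : S × (Fin c → ℝ≥0) × ℝ≥0) (e : α × ℝ≥0) : S × (Fin c → ℝ≥0) × ℝ≥0 :=
  ((A.step q.1 e.1 (fun x => cmp (q.2.1 x + (e.2 - q.2.2)) 1)).1,
    TimedAutomaton.resetClocks (A.step q.1 e.1 (fun x => cmp (q.2.1 x + (e.2 - q.2.2)) 1)).2
      (fun x => q.2.1 x + (e.2 - q.2.2)), e.2)

/-- The transition of the timed automaton that belongs to an argument of the step function. -/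
def transition (i : S × α × (Fin c → Ordering)) : Transition α S (Fin c) where
  src := i.1
  letter := i.2.1
  guard := .compareOnes i.2.2
  reset := (A.step i.1 i.2.1 i.2.2).2
  tgt := (A.step i.1 i.2.1 i.2.2).1

variable [Finite α] [Finite S]

/-- The timed automaton presented by a step function. -/
noncomputable def toTimedAutomaton : TimedAutomaton α S (Fin c) where
  init := A.init
  trans := (Set.finite_univ (α := S × α × (Fin c → Ordering))).toFinset.toList.map A.transition
  final := (Set.toFinite {s | A.accept s}).toFinset.toList

theorem toTimedAutomaton_deterministic : A.toTimedAutomaton.Deterministic := by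
  simp only [TimedAutomaton.Deterministic, toTimedAutomaton, List.mem_map]
  rintro _ ⟨i, -, rfl⟩ _ ⟨j, -, rfl⟩ hne h1 h2 ⟨v, h3, h4⟩
  rw [transition, Guard.sat_compareOnes] at h3 h4
  refine hne (congrArg _ ?_)
  exact Prod.ext h1 (Prod.ext h2 (h3.symm.trans h4))

theorem run_toTimedAutomaton (w : List (α × ℝ≥0)) (s s' : S) (v v' : Fin c → ℝ≥0) (τ : ℝ≥0) :
    A.toTimedAutomaton.Run s v τ w s' v' ↔
      (w.foldl A.next (s, v, τ)).1 = s' ∧ (w.foldl A.next (s, v, τ)).2.1 = v' := by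
  induction w generalizing s v τ with
  | nil => simp [TimedAutomaton.run_nil_iff, eq_comm]
  | cons e w ih =>
    obtain ⟨a, τ'⟩ := e
    rw [TimedAutomaton.run_cons_iff, List.foldl_cons]
    constructor
    · rintro ⟨d, hd, hs, ha, hg, hr⟩
      simp only [toTimedAutomaton, List.mem_map] at hd
      obtain ⟨i, -, rfl⟩ := hd
      rw [ih] at hr
      simp only [transition, Guard.sat_compareOnes] at hs ha hg hr
      simpa only [next, ← hs, ← ha, hg] using hr
    · intro h
      refine ⟨A.transition (s, a, fun x => cmp (v x + (τ' - τ)) 1), ?_, rfl, rfl, ?_, ?_⟩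
      · exact List.mem_map_of_mem (by simp)
      · rw [transition, Guard.sat_compareOnes]
      · rw [ih]
        exact h

theorem accepts_toTimedAutomaton (ρ : TimedWord α) :
    A.toTimedAutomaton.Accepts ρ ↔
      A.accept (ρ.events.foldl A.next (A.init, fun _ => 0, 0)).1 := by
  simp only [TimedAutomaton.Accepts, run_toTimedAutomaton]
  constructor
  · rintro ⟨s, v, ⟨rfl, rfl⟩, h⟩
    simpa [toTimedAutomaton] using h
  · intro h
    exact ⟨_, _, ⟨rfl, rfl⟩, by simpa [toTimedAutomaton] using h⟩

end StepAutomaton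

/-! ### Timestamps and letters of timed words -/

namespace TimedWord

variable {α : Type}

theorem letter_unique (ρ : TimedWord α) {a b : α} {t : ℝ≥0} (ha : (a, t) ∈ ρ.events)
    (hb : (b, t) ∈ ρ.events) : a = b := by
  obtain ⟨l, h⟩ := ρ
  induction l with
  | nil => simp at ha
  | cons e l ih =>
    rw [List.pairwise_cons] at h
    rcases List.mem_cons.1 ha with rfl | ha <;> rcases List.mem_cons.1 hb with hb | hb
    · exact (congrArg Prod.fst hb).symm
    · exact absurd (h.1 _ hb) (lt_irrefl _)
    · exact absurd (h.1 _ ha) (by simp [← hb])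
    · exact ih h.2 ha hb

theorem letterAt_eq_some (ρ : TimedWord α) {a : α} {t : ℝ≥0} :
    ρ.letterAt t = some a ↔ (a, t) ∈ ρ.events := by
  rw [letterAt, Option.map_eq_some_iff]
  constructor
  · rintro ⟨⟨b, s⟩, h, rfl⟩
    have h1 := List.mem_of_find?_eq_some h
    have h2 := List.find?_some h
    simp only [decide_eq_true_eq] at h2
    exact h2 ▸ h1
  · intro h
    cases hf : ρ.events.find? (fun e => decide (e.2 = t)) with
    | none =>
      rw [List.find?_eq_none] at hf
      exact absurd (hf _ h) (by simp)
    | some e =>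
      have h1 := List.mem_of_find?_eq_some hf
      have h2 := List.find?_some hf
      simp only [decide_eq_true_eq] at h2
      exact ⟨e, rfl, ρ.letter_unique (t := t) (h2 ▸ h1) h⟩

theorem mem_times (ρ : TimedWord α) {t : ℝ≥0} : t ∈ ρ.times ↔ ρ.HasTime t := by
  simp [times, HasTime]

/-- The timestamps of the interleaving of a family of timed words, in increasing order. -/
noncomputable def allTimes {ι : Type} [Fintype ι] (ρ : ι → TimedWord α) : List ℝ≥0 :=
  (Finset.univ.biUnion fun i => (ρ i).times).sort (· ≤ ·)

theorem mem_allTimes {ι : Type} [Fintype ι] (ρ : ι → TimedWord α) {t : ℝ≥0} :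
    t ∈ allTimes ρ ↔ ∃ i, (ρ i).HasTime t := by
  simp [allTimes, mem_times]

theorem pairwise_allTimes {ι : Type} [Fintype ι] (ρ : ι → TimedWord α) :
    (allTimes ρ).Pairwise (· < ·) :=
  (Finset.sortedLT_sort _).pairwise

theorem events_interleave {ι : Type} [Fintype ι] (ρ : ι → TimedWord α) :
    (interleave ρ).events = (allTimes ρ).map fun t => (fun i => (ρ i).letterAt t, t) :=
  rfl

end TimedWord

/-! ### Exactly negatable formulas -/

namespace QF

variable {P : Type}

/-- The negation normal form of `¬ψ` holds under `a` exactly where `ψ` does not. The atoms `p_π`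
lack this property, since neither `p_π` nor `¬p_π` holds where `π` has no event. -/
def Exact (a : Assignment P) (ψ : QF P) : Prop := ∀ t, Holds a false ψ t ↔ ¬ Holds a true ψ t

def or (ψ χ : QF P) : QF P := .neg (.and (.neg ψ) (.neg χ))

def bot : QF P := .and .top (.neg .top)

def bigOr (l : List (QF P)) : QF P := l.foldr or bot

def bigAnd (l : List (QF P)) : QF P := l.foldr .and (.neg bot)

/-- `⊤_π ∧ p_π` -/
def atomAt (p : P) (π : ℕ) : QF P := .and (.topAt π) (.atom p π)

variable {a : Assignment P}

theorem exact_top : Exact a .top := fun _ => Iff.rfl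

theorem exact_topAt (π : ℕ) : Exact a (.topAt π) := fun _ => Iff.rfl

theorem Exact.and {ψ χ : QF P} (h1 : Exact a ψ) (h2 : Exact a χ) : Exact a (.and ψ χ) := by
  intro t
  simp only [Holds, h1 t, h2 t]
  tauto

theorem Exact.neg {ψ : QF P} (h : Exact a ψ) : Exact a (.neg ψ) := by
  intro t
  simp only [Holds, h t]
  tauto

theorem Exact.since {ψ χ : QF P} (I : Interval) (h1 : Exact a ψ) (h2 : Exact a χ) :
    Exact a (.since I ψ χ) := by
  intro t
  have e1 : Holds a false ψ = fun s => ¬ Holds a true ψ s := funext fun s => propext (h1 s)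
  have e2 : Holds a false χ = fun s => ¬ Holds a true χ s := funext fun s => propext (h2 s)
  simp only [Holds, e1, e2]
  push Not
  refine forall_congr' fun t' => ?_
  refine forall_congr' fun _ => forall_congr' fun _ => forall_congr' fun _ => ?_
  exact imp_iff_not_or.symm

theorem Exact.untl {ψ χ : QF P} (I : Interval) (h1 : Exact a ψ) (h2 : Exact a χ) :
    Exact a (.untl I ψ χ) := by
  intro t
  have e1 : Holds a false ψ = fun s => ¬ Holds a true ψ s := funext fun s => propext (h1 s)
  have e2 : Holds a false χ = fun s => ¬ Holds a true χ s := funext fun s => propext (h2 s)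
  simp only [Holds, e1, e2]
  push Not
  refine forall_congr' fun t' => ?_
  refine forall_congr' fun _ => forall_congr' fun _ => forall_congr' fun _ => ?_
  exact imp_iff_not_or.symm

theorem Exact.or {ψ χ : QF P} (h1 : Exact a ψ) (h2 : Exact a χ) : Exact a (.or ψ χ) :=
  (h1.neg.and h2.neg).neg

theorem exact_bot : Exact a bot := exact_top.and exact_top.neg

theorem exact_bigOr {l : List (QF P)} (h : ∀ ψ ∈ l, Exact a ψ) : Exact a (bigOr l) := by
  induction l with
  | nil => exact exact_bot
  | cons ψ l ih => exact (h ψ (by simp)).or (ih fun χ hχ => h χ (by simp [hχ]))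

theorem exact_bigAnd {l : List (QF P)} (h : ∀ ψ ∈ l, Exact a ψ) : Exact a (bigAnd l) := by
  induction l with
  | nil => exact exact_bot.neg
  | cons ψ l ih => exact (h ψ (by simp)).and (ih fun χ hχ => h χ (by simp [hχ]))

theorem exact_atomAt (p : P) (π : ℕ) : Exact a (atomAt p π) := by
  intro t
  simp only [atomAt, Holds]
  constructor
  · rintro (h | ⟨ρ, hρ, σ, hσ, hp⟩)
    · exact fun h2 => h h2.1
    · rintro ⟨-, ρ', hρ', σ', hσ', hp'⟩
      obtain rfl := Option.mem_unique hρ hρ'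
      exact hp (ρ.letter_unique hσ hσ' ▸ hp')
  · intro h
    by_cases h1 : ∃ ρ ∈ a π, ρ.HasTime t
    · obtain ⟨ρ, hρ, σ, hσ⟩ := h1
      exact Or.inr ⟨ρ, hρ, σ, hσ, fun hp => h ⟨⟨ρ, hρ, σ, hσ⟩, ρ, hρ, σ, hσ, hp⟩⟩
    · exact Or.inl h1

theorem holds_neg {ψ : QF P} (h : Exact a ψ) (t : ℝ≥0) :
    Holds a true (.neg ψ) t ↔ ¬ Holds a true ψ t :=
  h t

theorem holds_or {ψ χ : QF P} (t : ℝ≥0) :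
    Holds a true (.or ψ χ) t ↔ Holds a true ψ t ∨ Holds a true χ t := by
  simp [or, Holds]

theorem holds_bot (t : ℝ≥0) : ¬ Holds a true bot t := by
  simp [bot, Holds]

theorem holds_bigOr {l : List (QF P)} (t : ℝ≥0) :
    Holds a true (bigOr l) t ↔ ∃ ψ ∈ l, Holds a true ψ t := by
  induction l with
  | nil => simp [bigOr, holds_bot]
  | cons ψ l ih => simp only [bigOr, List.foldr_cons, holds_or, List.exists_mem_cons_iff] at ih ⊢
                   rw [ih]

theorem holds_bigAnd {l : List (QF P)} (t : ℝ≥0) :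
    Holds a true (bigAnd l) t ↔ ∀ ψ ∈ l, Holds a true ψ t := by
  induction l with
  | nil => simp [bigAnd, holds_neg exact_bot, holds_bot]
  | cons ψ l ih => simp only [bigAnd, List.foldr_cons, Holds, List.forall_mem_cons] at ih ⊢
                   rw [ih]

theorem holds_atomAt (p : P) (π : ℕ) (t : ℝ≥0) :
    Holds a true (atomAt p π) t ↔ ∃ ρ ∈ a π, ∃ σ, (σ, t) ∈ ρ.events ∧ p ∈ σ := by
  simp only [atomAt, Holds, and_iff_right_iff_imp]
  rintro ⟨ρ, hρ, σ, hσ, -⟩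
  exact ⟨ρ, hρ, σ, hσ⟩

open Classical in
/-- The trace `π` has an event labelled exactly `σ`. -/
noncomputable def letterEq [Finite P] (σ : Finset P) (π : ℕ) : QF P :=
  .and (.topAt π) (bigAnd ((Set.finite_univ (α := P)).toFinset.toList.map fun p =>
    if p ∈ σ then atomAt p π else .neg (atomAt p π)))

/-- The trace `π` has an event whose label belongs to `A`. -/
noncomputable def letterIn [Finite P] (A : Set (Finset P)) (π : ℕ) : QF P :=
  bigOr ((Set.toFinite A).toFinset.toList.map fun σ => letterEq σ π)

theorem exact_letterEq [Finite P] (σ : Finset P) (π : ℕ) : Exact a (letterEq σ π) := by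
  refine (exact_topAt π).and (exact_bigAnd fun ψ hψ => ?_)
  obtain ⟨p, -, rfl⟩ := List.mem_map.1 hψ
  split_ifs
  · exact exact_atomAt _ _
  · exact (exact_atomAt _ _).neg

theorem exact_letterIn [Finite P] (A : Set (Finset P)) (π : ℕ) : Exact a (letterIn A π) := by
  refine exact_bigOr fun ψ hψ => ?_
  obtain ⟨p, -, rfl⟩ := List.mem_map.1 hψ
  exact exact_letterEq _ _

theorem holds_letterEq [Finite P] (σ : Finset P) (π : ℕ) (t : ℝ≥0) :
    Holds a true (letterEq σ π) t ↔ ∃ ρ ∈ a π, (σ, t) ∈ ρ.events := by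
  have key : Holds a true (letterEq σ π) t ↔ (∃ ρ ∈ a π, ρ.HasTime t) ∧
      ∀ p, (p ∈ σ ↔ ∃ ρ ∈ a π, ∃ σ', (σ', t) ∈ ρ.events ∧ p ∈ σ') := by
    simp only [letterEq, Holds, holds_bigAnd, List.forall_mem_map]
    refine and_congr Iff.rfl ?_
    simp only [Finset.mem_toList, Set.Finite.mem_toFinset, Set.mem_univ, forall_const]
    refine forall_congr' fun p => ?_
    split_ifs with h
    · simp [h, holds_atomAt]
    · rw [holds_neg (exact_atomAt _ _), holds_atomAt]
      simp [h]
  rw [key]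
  constructor
  · rintro ⟨⟨ρ, hρ, σ', hσ'⟩, h⟩
    have : σ = σ' := by
      ext p
      rw [h]
      constructor
      · rintro ⟨ρ2, hρ2, σ2, hσ2, hp⟩
        obtain rfl := Option.mem_unique hρ hρ2
        exact ρ.letter_unique hσ2 hσ' ▸ hp
      · exact fun hp => ⟨ρ, hρ, σ', hσ', hp⟩
    exact ⟨ρ, hρ, this ▸ hσ'⟩
  · rintro ⟨ρ, hρ, hσ⟩
    refine ⟨⟨ρ, hρ, σ, hσ⟩, fun p => ⟨fun hp => ⟨ρ, hρ, σ, hσ, hp⟩, ?_⟩⟩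
    rintro ⟨ρ2, hρ2, σ2, hσ2, hp⟩
    obtain rfl := Option.mem_unique hρ hρ2
    exact ρ.letter_unique hσ2 hσ ▸ hp

theorem holds_letterIn [Finite P] (A : Set (Finset P)) (π : ℕ) (t : ℝ≥0) :
    Holds a true (letterIn A π) t ↔ ∃ ρ ∈ a π, ∃ σ ∈ A, (σ, t) ∈ ρ.events := by
  rw [letterIn, holds_bigOr]
  constructor
  · rintro ⟨ψ, h, h4⟩
    obtain ⟨σ, h1, rfl⟩ := List.mem_map.1 h
    obtain ⟨ρ, h2, h3⟩ := (holds_letterEq _ _ _).1 h4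
    exact ⟨ρ, h2, σ, by simpa using h1, h3⟩
  · rintro ⟨ρ, h2, σ, h1, h3⟩
    exact ⟨_, List.mem_map_of_mem (by simpa using h1), (holds_letterEq _ _ _).2 ⟨ρ, h2, h3⟩⟩

end QF

theorem Interval.contains_univ (d : ℝ≥0) : Interval.univ.Contains d := by
  simp [Contains, univ]

/-! ### Past formulas over two traces -/

/-- Formulas about two traces that refer to the present and the past only. `letter i A` says that
the `i`-th trace has an event with a label in `A`, and `dist` stands for a property of the current
time that is specified separately. -/
inductive Past (P : Type)
  | letter : Fin 2 → Set (Finset P) → Past P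
  | dist : Past P
  | and : Past P → Past P → Past P
  | neg : Past P → Past P
  | since : Past P → Past P → Past P

/-- Some trace of the family has an event at time `t`. -/
def Active {ι P : Type} (w : ι → TimedWord (Finset P)) (t : ℝ≥0) : Prop := ∃ i, (w i).HasTime t

namespace Past

variable {P : Type}

/-- `ψ` is satisfied at time `t` by the pair of traces `w`, where `δ` interprets `dist`. -/
def Sat (w : Fin 2 → TimedWord (Finset P)) (δ : ℝ≥0 → Prop) : Past P → ℝ≥0 → Prop
  | letter i A, t => ∃ σ ∈ A, (σ, t) ∈ (w i).events
  | dist, t => δ t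
  | and ψ χ, t => ψ.Sat w δ t ∧ χ.Sat w δ t
  | neg ψ, t => ¬ ψ.Sat w δ t
  | since ψ χ, t => ∃ t', t' < t ∧ Active w t' ∧ χ.Sat w δ t' ∧
      ∀ t'', t' < t'' → t'' < t → Active w t'' → ψ.Sat w δ t''

/-- The HyperMTL formula that expresses a past formula, where `δ` expresses `dist` and the two
traces are named by the variables `0` and `1`. -/
noncomputable def toQF [Finite P] (δ : QF P) : Past P → QF P
  | letter i A => QF.letterIn A i
  | dist => δ
  | and ψ χ => .and (ψ.toQF δ) (χ.toQF δ)
  | neg ψ => .neg (ψ.toQF δ)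
  | since ψ χ => .since Interval.univ (ψ.toQF δ) (χ.toQF δ)

end Past

/-- The assignment that maps the variables `0` and `1` to the two traces. -/
def pairAssignment {P : Type} (w : Fin 2 → TimedWord (Finset P)) : Assignment P :=
  fun n => if h : n < 2 then some (w ⟨n, h⟩) else none

section pairAssignment

variable {P : Type} (w : Fin 2 → TimedWord (Finset P))

theorem mem_pairAssignment (i : Fin 2) (ρ : TimedWord (Finset P)) :
    ρ ∈ pairAssignment w i ↔ ρ = w i := by
  simp [pairAssignment, i.2, eq_comm]

theorem active_pairAssignment (t : ℝ≥0) : (pairAssignment w).Active t ↔ Active w t := by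
  constructor
  · rintro ⟨n, ρ, hρ, h⟩
    by_cases hn : n < 2
    · rw [mem_pairAssignment w ⟨n, hn⟩] at hρ
      exact ⟨⟨n, hn⟩, hρ ▸ h⟩
    · simp [pairAssignment, hn] at hρ
  · rintro ⟨i, h⟩
    exact ⟨i, w i, (mem_pairAssignment w i _).2 rfl, h⟩

theorem Past.exact_toQF [Finite P] {a : Assignment P} {δ : QF P} (hδ : δ.Exact a) (ψ : Past P) :
    (ψ.toQF δ).Exact a := by
  induction ψ with
  | letter i A => exact QF.exact_letterIn _ _
  | dist => exact hδ
  | and ψ χ h1 h2 => exact h1.and h2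
  | neg ψ h => exact h.neg
  | since ψ χ h1 h2 => exact h1.since _ h2

theorem Past.holds_toQF [Finite P] {δ : QF P} {d : ℝ≥0 → Prop}
    (he : δ.Exact (pairAssignment w)) (hδ : ∀ t, δ.Holds (pairAssignment w) true t ↔ d t)
    (ψ : Past P) (t : ℝ≥0) : (ψ.toQF δ).Holds (pairAssignment w) true t ↔ ψ.Sat w d t := by
  induction ψ generalizing t with
  | letter i A =>
    simp only [toQF, Sat, QF.holds_letterIn, mem_pairAssignment, exists_eq_left]
  | dist => exact hδ t
  | and ψ χ h1 h2 => simp only [toQF, Sat, QF.Holds, h1, h2]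
  | neg ψ h => rw [toQF, QF.holds_neg (ψ.exact_toQF he), h, Sat]
  | since ψ χ h1 h2 =>
    simp only [toQF, Sat, QF.Holds, h1, h2, active_pairAssignment, Interval.contains_univ,
      true_and]

end pairAssignment

/-! ### Automata that evaluate past formulas -/

section Tracking

variable {P ι : Type} [Fintype ι]

open TimedWord

/-- The letter of the interleaving at time `t`. -/
noncomputable def jointLetter (ρ : ι → TimedWord (Finset P)) (t : ℝ≥0) : ι → Option (Finset P) :=
  fun i => (ρ i).letterAt t

/-- A finite automaton, which also reads the truth value of `dist`, tells after each event of the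
interleaving whether `ψ` is satisfied at that event. The traces that `ψ` refers to are those with
the indices `e 0` and `e 1`. -/
def Past.Tracked (e : Fin 2 → ι) (δ : (Fin 2 → TimedWord (Finset P)) → ℝ≥0 → Prop)
    (ψ : Past P) : Prop :=
  ∃ (S : Type) (_ : Finite S) (s₀ : S) (step : S → (ι → Option (Finset P)) × Prop → S)
    (out : S → Prop), ∀ (ρ : ι → TimedWord (Finset P)) (pre : List ℝ≥0) (t : ℝ≥0),
      pre ++ [t] <+: allTimes ρ →
      (out ((pre ++ [t]).foldl (fun s t => step s (jointLetter ρ t, δ (ρ ∘ e) t)) s₀) ↔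
        ψ.Sat (ρ ∘ e) (δ (ρ ∘ e)) t)

/-- What the initial segments of a strictly increasing list say about the order. -/
theorem mem_of_prefix {l pre : List ℝ≥0} (hl : l.Pairwise (· < ·)) {t : ℝ≥0}
    (h : pre ++ [t] <+: l) (s : ℝ≥0) : s ∈ pre ↔ s ∈ l ∧ s < t := by
  obtain ⟨post, rfl⟩ := h
  simp only [List.append_assoc, List.singleton_append, List.pairwise_append,
    List.pairwise_cons, List.mem_append, List.mem_cons] at hl ⊢
  constructor
  · intro hs
    exact ⟨Or.inl hs, hl.2.2 s hs t (Or.inl rfl)⟩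
  · rintro ⟨hs | rfl | hs, hlt⟩
    · exact hs
    · exact absurd hlt (lt_irrefl _)
    · exact absurd hlt (hl.2.1.1 s hs).not_gt

theorem active_comp_iff {e : Fin 2 → ι} (he : Function.Surjective e)
    (ρ : ι → TimedWord (Finset P)) (t : ℝ≥0) : Active (ρ ∘ e) t ↔ t ∈ allTimes ρ := by
  rw [mem_allTimes]
  exact (he.exists (p := fun i => (ρ i).HasTime t)).symm

/-- The recurrence for `since` along the events. -/
theorem Past.sat_since_succ {w : Fin 2 → TimedWord (Finset P)} {δ : ℝ≥0 → Prop} (ψ χ : Past P)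
    {s t : ℝ≥0} (hs : Active w s) (hst : s < t) (hnext : ∀ r, Active w r → r < t → r ≤ s) :
    (Past.since ψ χ).Sat w δ t ↔
      χ.Sat w δ s ∨ (ψ.Sat w δ s ∧ (Past.since ψ χ).Sat w δ s) := by
  constructor
  · rintro ⟨t', h1, h2, h3, h4⟩
    rcases (hnext t' h2 h1).eq_or_lt with rfl | hlt
    · exact Or.inl h3
    · exact Or.inr ⟨h4 s hlt hst hs, t', hlt, h2, h3, fun r hr hr2 => h4 r hr (hr2.trans hst)⟩
  · rintro (h | ⟨h1, t', h2, h3, h4, h5⟩)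
    · exact ⟨s, hst, hs, h, fun r h1 h2 h3 => absurd h1 (hnext r h3 h2).not_gt⟩
    · refine ⟨t', h2.trans hst, h3, h4, fun r hr1 hr2 hr3 => ?_⟩
      rcases (hnext r hr3 hr2).eq_or_lt with rfl | hlt
      · exact h1
      · exact h5 r hr1 hlt hr3

theorem Past.tracked {e : Fin 2 → ι} (he : Function.Surjective e)
    (δ : (Fin 2 → TimedWord (Finset P)) → ℝ≥0 → Prop) (ψ : Past P) : ψ.Tracked e δ := by
  induction ψ with
  | letter i A =>
    refine ⟨Prop, inferInstance, True, fun _ a => ∃ σ ∈ A, a.1 (e i) = some σ, id, ?_⟩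
    intro ρ pre t _
    simp [List.foldl_append, jointLetter, Sat, letterAt_eq_some]
  | dist =>
    refine ⟨Prop, inferInstance, True, fun _ a => a.2, id, ?_⟩
    intro ρ pre t _
    simp [List.foldl_append, Sat]
  | and ψ χ h1 h2 =>
    obtain ⟨S, _, s, step, out, h1⟩ := h1
    obtain ⟨S', _, s', step', out', h2⟩ := h2
    refine ⟨S × S', inferInstance, (s, s'), fun q a => (step q.1 a, step' q.2 a),
      fun q => out q.1 ∧ out' q.2, ?_⟩
    intro ρ pre t hp
    rw [Sat, ← h1 ρ pre t hp, ← h2 ρ pre t hp]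
    generalize pre ++ [t] = l
    clear hp h1 h2
    induction l generalizing s s' <;> simp_all
  | neg ψ h =>
    obtain ⟨S, _, s, step, out, h⟩ := h
    refine ⟨S, inferInstance, s, step, fun q => ¬ out q, ?_⟩
    intro ρ pre t hp
    rw [Sat, ← h ρ pre t hp]
  | since ψ χ h1 h2 =>
    obtain ⟨S, _, s, step, out, h1⟩ := h1
    obtain ⟨S', _, s', step', out', h2⟩ := h2
    -- The last component is the truth value of the formula at the last event, if any.
    refine ⟨S × S' × Option Prop, inferInstance, (s, s', none),
      fun q a => (step q.1 a, step' q.2.1 a,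
        some (q.2.2.elim False fun b => out' q.2.1 ∨ (out q.1 ∧ b))),
      fun q => q.2.2.elim False id, ?_⟩
    intro ρ pre t hp
    set F := fun (q : S × S' × Option Prop) (t : ℝ≥0) =>
      (step q.1 (jointLetter ρ t, δ (ρ ∘ e) t), step' q.2.1 (jointLetter ρ t, δ (ρ ∘ e) t),
        some (q.2.2.elim False fun b => out' q.2.1 ∨ (out q.1 ∧ b))) with hF
    have hfst : ∀ l : List ℝ≥0, (l.foldl F (s, s', none)).1 =
        l.foldl (fun s t => step s (jointLetter ρ t, δ (ρ ∘ e) t)) s ∧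
        (l.foldl F (s, s', none)).2.1 =
        l.foldl (fun s t => step' s (jointLetter ρ t, δ (ρ ∘ e) t)) s' := by
      intro l
      induction l using List.reverseRecOn with
      | nil => exact ⟨rfl, rfl⟩
      | append_singleton l t ih =>
        simp only [List.foldl_append, List.foldl_cons, List.foldl_nil, ← ih.1, ← ih.2]
        exact ⟨rfl, rfl⟩
    induction pre using List.reverseRecOn generalizing t with
    | nil =>
      simp only [List.nil_append, List.foldl_cons, List.foldl_nil, hF, Option.elim, id,
        false_iff]
      rintro ⟨t', h3, h4, -⟩
      have := (mem_of_prefix (pairwise_allTimes ρ) hp t').2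
        ⟨(active_comp_iff he ρ t').1 h4, h3⟩
      simp at this
    | append_singleton pre r ih =>
      have hp' : pre ++ [r] <+: allTimes ρ := (List.prefix_append _ _).trans hp
      have hmem := mem_of_prefix (pairwise_allTimes ρ) hp
      have hmem' := mem_of_prefix (pairwise_allTimes ρ) hp'
      have hr := (hmem r).1 (by simp)
      have ih' : ((pre ++ [r]).foldl F (s, s', none)).2.2.elim False id ↔
          (Past.since ψ χ).Sat (ρ ∘ e) (δ (ρ ∘ e)) r := ih r hp'
      rw [Past.sat_since_succ ψ χ ((active_comp_iff he ρ r).2 hr.1) hr.2, ← ih',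
        ← h1 ρ pre r hp', ← h2 ρ pre r hp']
      · rw [← (hfst _).1, ← (hfst _).2, List.foldl_append (l' := [t])]
        have : ∃ b, ((pre ++ [r]).foldl F (s, s', none)).2.2 = some b := by
          rw [List.foldl_append]
          exact ⟨_, rfl⟩
        obtain ⟨b, hb⟩ := this
        rw [List.foldl_cons, List.foldl_nil]
        generalize (pre ++ [r]).foldl F (s, s', none) = q at hb ⊢
        obtain ⟨q1, q2, q3⟩ := q
        obtain rfl : q3 = some b := hb
        rfl
      · intro r' h3 h4
        have := (hmem r').2 ⟨(active_comp_iff he ρ r').1 h3, h4⟩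
        rcases List.mem_append.1 this with h | h
        · exact ((hmem' r').1 h).2.le
        · exact (List.mem_singleton.1 h).le

end Tracking

/-- An automaton with `c` clocks that computes the truth value of `dist` at each event of the
interleaving. The value is a function of the state before the event, the letter, and how the
clocks compare with `1`. -/
structure DistAutomaton {P ι : Type} [Fintype ι] (e : Fin 2 → ι)
    (δ : (Fin 2 → TimedWord (Finset P)) → ℝ≥0 → Prop) (c : ℕ) where
  State : Type
  finite : Finite State
  toStep : StepAutomaton (ι → Option (Finset P)) State c
  value : State → (ι → Option (Finset P)) → (Fin c → Ordering) → Prop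
  value_iff : ∀ (ρ : ι → TimedWord (Finset P)) (pre : List ℝ≥0) (t : ℝ≥0),
    pre ++ [t] <+: TimedWord.allTimes ρ → ∀ q,
    q = (pre.map fun t => (jointLetter ρ t, t)).foldl toStep.next (toStep.init, fun _ => 0, 0) →
    (value q.1 (jointLetter ρ t) (fun x => cmp (q.2.1 x + (t - q.2.2)) 1) ↔ δ (ρ ∘ e) t)

/-- If `dist` can be computed by an automaton with `c` clocks, then whether the interleaving has a
last event and a past formula is satisfied there can be decided by a deterministic timed automaton
with `c` clocks. The predicate `acc` allows for complementation. -/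
theorem exists_timedAutomaton_of_past {P ι : Type} [Finite P] [Fintype ι] {e : Fin 2 → ι}
    (he : Function.Surjective e) {δ : (Fin 2 → TimedWord (Finset P)) → ℝ≥0 → Prop} {c : ℕ}
    (D : DistAutomaton e δ c) (ψ : Past P) (acc : Prop → Prop) :
    ∃ (S : Type) (_ : Finite S) (B : TimedAutomaton (ι → Option (Finset P)) S (Fin c)),
      B.Deterministic ∧ ∀ ρ : ι → TimedWord (Finset P),
        B.Accepts (TimedWord.interleave ρ) ↔
          acc (∃ pre t, TimedWord.allTimes ρ = pre ++ [t] ∧ ψ.Sat (ρ ∘ e) (δ (ρ ∘ e)) t) := by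
  obtain ⟨S, _, s₀, step, out, h⟩ := ψ.tracked he δ
  have := D.finite
  let A : StepAutomaton (ι → Option (Finset P)) (D.State × S × Prop) c :=
    { init := (D.toStep.init, s₀, False)
      step := fun s a o => (((D.toStep.step s.1 a o).1, step s.2.1 (a, D.value s.1 a o), True),
        (D.toStep.step s.1 a o).2)
      accept := fun s => acc (s.2.2 ∧ out s.2.1) }
  refine ⟨_, inferInstance, A.toTimedAutomaton, A.toTimedAutomaton_deterministic, fun ρ => ?_⟩
  rw [A.accepts_toTimedAutomaton, TimedWord.events_interleave]
  -- The run of `A` is the product of the run that computes `dist` and the run that evaluates `ψ`.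
  have key : ∀ l, l <+: TimedWord.allTimes ρ → ∀ q q',
      q = (l.map fun t => (jointLetter ρ t, t)).foldl A.next (A.init, fun _ => 0, 0) →
      q' = (l.map fun t => (jointLetter ρ t, t)).foldl D.toStep.next
        (D.toStep.init, fun _ => 0, 0) →
      q.1.1 = q'.1 ∧ q.2 = q'.2 ∧
      q.1.2.1 = l.foldl (fun s t => step s (jointLetter ρ t, δ (ρ ∘ e) t)) s₀ ∧
      (q.1.2.2 ↔ l ≠ []) := by
    intro l
    induction l using List.reverseRecOn with
    | nil => rintro - q q' rfl rfl; simp [A]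
    | append_singleton l t ih =>
      intro hp q q' hq hq'
      obtain ⟨h1, h2, h3, h4⟩ := ih ((List.prefix_append _ _).trans hp) _ _ rfl rfl
      have hv := D.value_iff ρ l t hp _ rfl
      simp only [List.map_append, List.foldl_append, List.map_cons, List.map_nil,
        List.foldl_cons, List.foldl_nil] at hq hq' ⊢
      generalize (l.map fun t => (jointLetter ρ t, t)).foldl A.next (A.init, fun _ => 0, 0) = p
        at *
      generalize (l.map fun t => (jointLetter ρ t, t)).foldl D.toStep.next
        (D.toStep.init, fun _ => 0, 0) = p' at *
      obtain ⟨⟨p1, p2, p3⟩, p4, p5⟩ := p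
      obtain ⟨p1', p4', p5'⟩ := p'
      simp only [Prod.mk.injEq] at h1 h2 h3 h4
      obtain ⟨rfl, rfl⟩ := h2
      subst h1 h3
      subst hq hq'
      simp only [StepAutomaton.next, A] at hv ⊢
      simp [hv]
  obtain ⟨-, -, h3, h4⟩ := key _ (List.prefix_refl _) _ _ rfl rfl
  change acc (_ ∧ out _) ↔ _
  refine iff_of_eq (congrArg acc (propext ?_))
  refine (and_congr h4 (iff_of_eq (congrArg out h3))).trans ?_
  constructor
  · rintro ⟨hne, ho⟩
    obtain ⟨pre, t, hpt⟩ := (List.eq_nil_or_concat _).resolve_left hne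
    rw [List.concat_eq_append] at hpt
    rw [hpt, h ρ pre t (by rw [hpt])] at ho
    exact ⟨pre, t, hpt, ho⟩
  · rintro ⟨pre, t, hpt, ho⟩
    rw [hpt, h ρ pre t (by rw [hpt])]
    exact ⟨by simp, ho⟩

/-! ### Two ways to recognize time distance one -/

/-- The first event of `ρ` is at time `t`. -/
def TimedWord.FirstAt {α : Type} (ρ : TimedWord α) (t : ℝ≥0) : Prop :=
  ρ.HasTime t ∧ ∀ s, s < t → ¬ ρ.HasTime s

theorem TimedWord.FirstAt.unique {α : Type} {ρ : TimedWord α} {s t : ℝ≥0} (hs : ρ.FirstAt s)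
    (ht : ρ.FirstAt t) : s = t :=
  le_antisymm (not_lt.1 fun h => hs.2 t h ht.1) (not_lt.1 fun h => ht.2 s h hs.1)

section Clocked

variable {P ι : Type} [Fintype ι]

/-- `dist` as a timed property: one time unit has passed since the first event of the second
trace. -/
def unitSinceFirst (w : Fin 2 → TimedWord (Finset P)) (t : ℝ≥0) : Prop :=
  ∃ s, (w 1).FirstAt s ∧ t = s + 1

open Classical in
/-- The step function resets the clock at all events up to the first one of the second trace, which
is remembered in the state. -/
noncomputable def unitSinceFirstStep (i : ι) :
    StepAutomaton (ι → Option (Finset P)) Prop 1 where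
  init := False
  step s a _ := (s ∨ ∃ σ, a i = some σ, if s then ∅ else {0})
  accept _ := True

theorem unitSinceFirstStep_run (i : ι) (ρ : ι → TimedWord (Finset P)) (pre : List ℝ≥0)
    (hpre : pre <+: TimedWord.allTimes ρ) (q : Prop × (Fin 1 → ℝ≥0) × ℝ≥0)
    (hq : q = (pre.map fun t => (jointLetter ρ t, t)).foldl (unitSinceFirstStep i).next
      ((unitSinceFirstStep (P := P) i).init, fun _ => 0, 0)) :
    (q.1 ↔ ∃ t ∈ pre, (ρ i).HasTime t) ∧ (q.2.2 = 0 ∨ q.2.2 ∈ pre) ∧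
      (q.1 → ∃ s, (ρ i).FirstAt s ∧ q.2.1 0 + s = q.2.2) := by
  induction pre using List.reverseRecOn generalizing q with
  | nil => subst hq; simp [unitSinceFirstStep]
  | append_singleton pre t ih =>
    obtain ⟨h1, h2, h3⟩ := ih ((List.prefix_append _ _).trans hpre) _ rfl
    have hmem := mem_of_prefix (TimedWord.pairwise_allTimes ρ) hpre
    simp only [List.map_append, List.foldl_append, List.map_cons, List.map_nil,
      List.foldl_cons, List.foldl_nil] at hq
    generalize (pre.map fun t => (jointLetter ρ t, t)).foldl (unitSinceFirstStep i).next
      ((unitSinceFirstStep (P := P) i).init, fun _ => 0, 0) = p at *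
    obtain ⟨p1, p2, p3⟩ := p
    subst hq
    have hle : p3 ≤ t := by
      rcases h2 with h2 | h2
      · exact le_of_eq_of_le h2 zero_le
      · exact ((hmem p3).1 h2).2.le
    have hlet : (∃ σ, jointLetter ρ t i = some σ) ↔ (ρ i).HasTime t := by
      simp [jointLetter, TimedWord.letterAt_eq_some, TimedWord.HasTime]
    simp only at h1 h2 h3
    simp only [unitSinceFirstStep, StepAutomaton.next, hlet]
    refine ⟨?_, Or.inr (by simp), ?_⟩
    · rw [h1]
      simp [or_and_right, exists_or]
    · intro h
      by_cases hp1 : p1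
      · obtain ⟨s, hs, hs2⟩ := h3 hp1
        refine ⟨s, hs, ?_⟩
        simp only [hp1, if_true, TimedAutomaton.resetClocks, Finset.notMem_empty, if_false]
        rw [add_right_comm, hs2, add_tsub_cancel_of_le hle]
      · refine ⟨t, ⟨h.resolve_left hp1, fun s hs hs2 => hp1 (h1.2 ⟨s, ?_, hs2⟩)⟩, ?_⟩
        · exact (hmem s).2 ⟨(TimedWord.mem_allTimes ρ).2 ⟨i, hs2⟩, hs⟩
        · simp [hp1, TimedAutomaton.resetClocks]

/-- One clock is enough to recognize `unitSinceFirst`. -/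
noncomputable def unitSinceFirstAutomaton (e : Fin 2 → ι) :
    DistAutomaton (P := P) e unitSinceFirst 1 where
  State := Prop
  finite := inferInstance
  toStep := unitSinceFirstStep (e 1)
  value s _ o := s ∧ o 0 = .eq
  value_iff := by
    intro ρ pre t hp q hq
    have hmem := mem_of_prefix (TimedWord.pairwise_allTimes ρ) hp
    obtain ⟨h1, h2, h3⟩ :=
      unitSinceFirstStep_run (e 1) ρ pre ((List.prefix_append _ _).trans hp) q hq
    have hle : q.2.2 ≤ t := by
      rcases h2 with h2 | h2
      · exact le_of_eq_of_le h2 zero_le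
      · exact ((hmem _).1 h2).2.le
    rw [cmp_eq_eq_iff]
    constructor
    · rintro ⟨hq1, h⟩
      obtain ⟨s, hs, hs2⟩ := h3 hq1
      refine ⟨s, hs, ?_⟩
      rw [← h, add_comm, add_right_comm, hs2, add_tsub_cancel_of_le hle]
    · rintro ⟨s, hs, rfl⟩
      have hq1 : q.1 := h1.2 ⟨s, (hmem s).2 ⟨(TimedWord.mem_allTimes ρ).2 ⟨_, hs.1⟩,
        lt_add_one s⟩, hs.1⟩
      obtain ⟨s', hs', hs2⟩ := h3 hq1
      obtain rfl : s = s' := hs.unique hs'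
      refine ⟨hq1, ?_⟩
      have : q.2.1 0 + (s + 1 - q.2.2) + s = 1 + s := by
        rw [add_right_comm, hs2, add_tsub_cancel_of_le hle, add_comm]
      exact add_right_cancel this

/-- `dist` as an untimed property: the second trace has an event whose label contains `d`. -/
def flagged (d : P) (w : Fin 2 → TimedWord (Finset P)) (t : ℝ≥0) : Prop :=
  ∃ σ, (σ, t) ∈ (w 1).events ∧ d ∈ σ

/-- No clock is needed to recognize `flagged`. -/
def flaggedAutomaton (d : P) (e : Fin 2 → ι) : DistAutomaton e (flagged d) 0 where
  State := Unit
  finite := inferInstance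
  toStep := { init := (), step := fun _ _ _ => ((), ∅), accept := fun _ => True }
  value _ a _ := ∃ σ, a (e 1) = some σ ∧ d ∈ σ
  value_iff := by
    intro ρ pre t _ q _
    simp [flagged, jointLetter, TimedWord.letterAt_eq_some]

end Clocked

/-- The first event of the trace `1`. -/
def firstQF (P : Type) : QF P :=
  .and (.topAt 1) (.neg (.since Interval.univ .top (.topAt 1)))

/-- The formula for `unitSinceFirst`. Punctual intervals are not available, so distance one is
expressed as distance at least one but not more. -/
def unitSinceFirstQF (P : Type) : QF P :=
  .and (.since ⟨1, true, none, by simp⟩ .top (firstQF P))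
    (.neg (.since ⟨1, false, none, by simp⟩ .top (firstQF P)))

section Expressing

variable {P : Type}

theorem exact_firstQF (a : Assignment P) : (firstQF P).Exact a :=
  (QF.exact_topAt 1).and (QF.exact_top.since _ (QF.exact_topAt 1)).neg

theorem exact_unitSinceFirstQF (a : Assignment P) : (unitSinceFirstQF P).Exact a :=
  (QF.exact_top.since _ (exact_firstQF a)).and (QF.exact_top.since _ (exact_firstQF a)).neg

theorem holds_topAt_one (w : Fin 2 → TimedWord (Finset P)) (t : ℝ≥0) :
    (QF.topAt 1).Holds (pairAssignment w) true t ↔ (w 1).HasTime t := by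
  have := mem_pairAssignment w 1
  simp only [Fin.val_one] at this
  simp [QF.Holds, this]

theorem holds_firstQF (w : Fin 2 → TimedWord (Finset P)) (t : ℝ≥0) :
    (firstQF P).Holds (pairAssignment w) true t ↔ (w 1).FirstAt t := by
  have h : ∀ t, (QF.since Interval.univ .top (.topAt 1)).Holds (pairAssignment w) true t ↔
      ∃ s, s < t ∧ (w 1).HasTime s := by
    intro t
    rw [QF.Holds]
    refine exists_congr fun s => and_congr_right fun _ => ?_
    simp only [Interval.contains_univ, active_pairAssignment, holds_topAt_one, true_and]
    refine ⟨fun h => h.2.1, fun h => ⟨⟨1, h⟩, h, fun s' _ _ h' => ?_⟩⟩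
    exact (active_pairAssignment w s').2 h'
  rw [firstQF, QF.Holds, holds_topAt_one,
    QF.holds_neg (QF.exact_top.since _ (QF.exact_topAt 1)), h]
  simp [TimedWord.FirstAt]

theorem holds_unitSinceFirstQF (w : Fin 2 → TimedWord (Finset P)) (t : ℝ≥0) :
    (unitSinceFirstQF P).Holds (pairAssignment w) true t ↔ unitSinceFirst w t := by
  have h : ∀ (I : Interval) (t : ℝ≥0),
      (QF.since I .top (firstQF P)).Holds (pairAssignment w) true t ↔
      ∃ s, s < t ∧ I.Contains (t - s) ∧ (w 1).FirstAt s := by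
    intro I t
    rw [QF.Holds]
    refine exists_congr fun s => and_congr_right fun _ => and_congr_right fun _ => ?_
    simp only [active_pairAssignment, holds_firstQF]
    refine ⟨fun h => h.2.1, fun h => ⟨⟨1, h.1⟩, h, fun s' _ _ h' => ?_⟩⟩
    exact (active_pairAssignment w s').2 h'
  rw [unitSinceFirstQF, QF.Holds, QF.holds_neg (QF.exact_top.since _ (exact_firstQF _)), h, h]
  simp only [Interval.Contains, Nat.cast_one, if_true, Option.mem_def, reduceCtorEq,
    IsEmpty.forall_iff, implies_true, and_true, Bool.false_eq_true, if_false, not_exists]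
  constructor
  · rintro ⟨⟨s, h1, h2, h3⟩, h4⟩
    refine ⟨s, h3, le_antisymm ?_ ?_⟩
    · by_contra hlt
      exact h4 s ⟨h1, lt_tsub_iff_left.2 (not_le.1 hlt), h3⟩
    · rwa [le_tsub_iff_left h1.le] at h2
  · rintro ⟨s, h, rfl⟩
    refine ⟨⟨s, lt_add_one s, by simp, h⟩, ?_⟩
    rintro s' ⟨-, h2, h3⟩
    obtain rfl := h.unique h3
    simp at h2

theorem holds_flaggedQF (d : P) (w : Fin 2 → TimedWord (Finset P)) (t : ℝ≥0) :
    (QF.atomAt d 1).Holds (pairAssignment w) true t ↔ flagged d w t := by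
  have := mem_pairAssignment w 1
  simp only [Fin.val_one] at this
  simp [QF.holds_atomAt, this, flagged]

end Expressing

/-! ### Computations written on a helix -/

section Helix

variable {Γ Λ : Type} [Inhabited Γ] [Inhabited Λ]

/-- A cell is either a wall (`none`), or holds a tape symbol and, if the head is there, the state
of the machine. -/
abbrev Cell (Γ Λ : Type) : Type := Option (Γ × Option Λ)

/-- A tile shows a cell (in the middle) together with its two neighbours. -/
abbrev Tile (Γ Λ : Type) : Type := Cell Γ Λ × Cell Γ Λ × Cell Γ Λ

/-- If the head is in the cell and moves out of it in direction `d`, the state it moves with. -/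
def leaving (M : TM0.Machine Γ Λ) (d : Dir) : Cell Γ Λ → Option Λ
  | some (a, some q) =>
    match M q a with
    | some (q', .move d') => if d' = d then some q' else none
    | _ => none
  | _ => none

/-- The content of a cell after one step of the machine, given the cell and its neighbours. -/
def nextCell (M : TM0.Machine Γ Λ) : Tile Γ Λ → Cell Γ Λ
  | (_, none, _) => none
  | (_, some (a, some q), _) =>
    match M q a with
    | some (q', .write b) => some (b, some q')
    | some (_, .move _) => some (a, none)
    | none => some (a, some q)
  | (x, some (a, none), z) => some (a, (leaving M .right x).or (leaving M .left z))

/-- The head does not run into a wall. -/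
def Tile.Safe (M : TM0.Machine Γ Λ) (b : Tile Γ Λ) : Prop :=
  (b.1 = none → leaving M .left b.2.1 = none) ∧ (b.2.2 = none → leaving M .right b.2.1 = none)

/-- `b` may follow `a` immediately. -/
def Tile.Adjacent (M : TM0.Machine Γ Λ) (a b : Tile Γ Λ) : Prop :=
  b.1 = a.2.1 ∧ b.2.1 = a.2.2 ∧ a.Safe M

/-- `b` may stand one row below `a`. -/
def Tile.Below (M : TM0.Machine Γ Λ) (a b : Tile Γ Λ) : Prop := b.2.1 = nextCell M a

/-- The machine halts with the head in the middle cell. -/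
def Tile.Halting (M : TM0.Machine Γ Λ) (b : Tile Γ Λ) : Prop :=
  ∃ a q, b.2.1 = some (a, some q) ∧ M q a = none

/-- The cell at position `n` relative to the head. -/
def cellOf (C : TM0.Cfg Γ Λ) (n : ℤ) : Cell Γ Λ :=
  some (C.Tape.nth n, if n = 0 then some C.q else none)

/-- A word `c 0, …, c L` of tiles that describes a computation of `M` on input `l`: the word is
wound up in rows of length `N`, each row begins with a wall, followed by a section of the tape, and
is obtained from the previous row by one step of the machine. -/
structure IsHelix (M : TM0.Machine Γ Λ) (l : List Γ) (N L : ℕ) (c : ℕ → Tile Γ Λ) : Prop where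
  le_length : N ≤ L + 1
  below : ∀ k, k + N ≤ L → (c k).Below M (c (k + N))
  adjacent : ∀ k, k < L → (c k).Adjacent M (c (k + 1))
  wall : (c 0).2.1 = none
  input : ∃ p, 1 ≤ p ∧ p + l.length ≤ N ∧
    ∀ j, 0 < j → j < N → (c j).2.1 = cellOf (TM0.init l) ((j : ℤ) - p)

/-- One step of the machine, which stays in halting configurations. -/
def stepOrStay (M : TM0.Machine Γ Λ) (C : TM0.Cfg Γ Λ) : TM0.Cfg Γ Λ := (TM0.step M C).getD C

/-- The displacement of the head in one step. -/
def headShift (M : TM0.Machine Γ Λ) (C : TM0.Cfg Γ Λ) : ℤ :=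
  match M C.q C.Tape.head with
  | some (_, .move .left) => -1
  | some (_, .move .right) => 1
  | _ => 0

theorem leaving_cellOf_of_ne (M : TM0.Machine Γ Λ) (d : Dir) (C : TM0.Cfg Γ Λ) {n : ℤ}
    (h : n ≠ 0) : leaving M d (cellOf C n) = none := by
  simp [cellOf, h, leaving]

/-- The local rule `nextCell` describes a step of the machine, also for cells next to a wall that
is not at the position of the head. -/
theorem nextCell_cellOf (M : TM0.Machine Γ Λ) (C : TM0.Cfg Γ Λ) (n : ℤ) (x z : Cell Γ Λ)
    (hx : x = cellOf C (n - 1) ∨ (x = none ∧ n - 1 ≠ 0))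
    (hz : z = cellOf C (n + 1) ∨ (z = none ∧ n + 1 ≠ 0)) :
    nextCell M (x, cellOf C n, z) = cellOf (stepOrStay M C) (n - headShift M C) := by
  obtain ⟨q, T⟩ := C
  have hm1 : (T.move .right).head = T.nth 1 := by
    rw [← Tape.nth_zero, Tape.move_right_nth, zero_add]
  have hm2 : (T.move .left).head = T.nth (-1) := by
    rw [← Tape.nth_zero, Tape.move_left_nth, zero_sub]
  have hm3 : ∀ b, (T.write b).head = b := fun b => rfl
  have hx' : n - 1 ≠ 0 → leaving M .right x = none := by
    intro h
    rcases hx with rfl | ⟨rfl, -⟩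
    · exact leaving_cellOf_of_ne _ _ _ h
    · rfl
  have hz' : n + 1 ≠ 0 → leaving M .left z = none := by
    intro h
    rcases hz with rfl | ⟨rfl, -⟩
    · exact leaving_cellOf_of_ne _ _ _ h
    · rfl
  by_cases hn : n = 0
  · subst hn
    rcases hM : M q T.head with _ | ⟨q', (_ | _) | b⟩ <;>
      simp [cellOf, nextCell, hM, headShift, stepOrStay, TM0.step, hm3, Tape.move_left_nth,
        Tape.move_right_nth]
  · have hx1 : n = 1 → leaving M .right x = leaving M .right (cellOf ⟨q, T⟩ 0) := by
      rintro rfl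
      rcases hx with rfl | ⟨-, h⟩
      · rfl
      · exact absurd rfl h
    have hz1 : n = -1 → leaving M .left z = leaving M .left (cellOf ⟨q, T⟩ 0) := by
      rintro rfl
      rcases hz with rfl | ⟨-, h⟩
      · rfl
      · exact absurd rfl h
    have e : nextCell M (x, cellOf ⟨q, T⟩ n, z) =
        some (T.nth n, (leaving M .right x).or (leaving M .left z)) := by
      simp [cellOf, hn, nextCell]
    rw [e]
    by_cases h1 : n = 1
    · rw [hx1 h1, hz' (by omega)]
      subst h1
      rcases hM : M q T.head with _ | ⟨q', (_ | _) | b⟩ <;>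
        simp [cellOf, leaving, hM, headShift, stepOrStay, TM0.step, hm1, Tape.move_left_nth]
    · by_cases h2 : n = -1
      · rw [hz1 h2, hx' (by omega)]
        subst h2
        rcases hM : M q T.head with _ | ⟨q', (_ | _) | b⟩ <;>
          simp [cellOf, leaving, hM, headShift, stepOrStay, TM0.step, hm2,
            Tape.move_right_nth]
      · rw [hx' (by omega), hz' (by omega)]
        have h3 : n + 1 ≠ 0 := by omega
        have h4 : n - 1 ≠ 0 := by omega
        rcases hM : M q T.head with _ | ⟨q', (_ | _) | b⟩ <;>
          simp [cellOf, hM, headShift, stepOrStay, TM0.step, Tape.move_left_nth,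
            Tape.move_right_nth, hn, h3, h4]

theorem headShift_cases (M : TM0.Machine Γ Λ) (C : TM0.Cfg Γ Λ) :
    headShift M C = 0 ∨ (headShift M C = -1 ∧ leaving M .left (cellOf C 0) ≠ none) ∨
      (headShift M C = 1 ∧ leaving M .right (cellOf C 0) ≠ none) := by
  obtain ⟨q, T⟩ := C
  rcases hM : M q T.head with _ | ⟨q', (_ | _) | b⟩ <;> simp [headShift, cellOf, leaving, hM]

theorem leaving_cellOf_ne_none {M : TM0.Machine Γ Λ} {C : TM0.Cfg Γ Λ} {n : ℤ} :
    (leaving M .left (cellOf C n) ≠ none → n = 0 ∧ headShift M C = -1 ∧ TM0.step M C ≠ none) ∧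
    (leaving M .right (cellOf C n) ≠ none → n = 0 ∧ headShift M C = 1 ∧ TM0.step M C ≠ none) := by
  by_cases hn : n = 0
  · subst hn
    obtain ⟨q, T⟩ := C
    rcases hM : M q T.head with _ | ⟨q', (_ | _) | b⟩ <;>
      simp [headShift, cellOf, leaving, hM, TM0.step]
  · simp [leaving_cellOf_of_ne _ _ _ hn]

/-- A helix with a halting tile describes a halting computation. -/
theorem IsHelix.dom {M : TM0.Machine Γ Λ} {l : List Γ} {N L : ℕ} {c : ℕ → Tile Γ Λ}
    (h : IsHelix M l N L c) (hl : l ≠ []) {k : ℕ} (hk : k ≤ L) (hhalt : (c k).Halting M) :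
    (eval (TM0.step M) (TM0.init l)).Dom := by
  have hlen : 0 < l.length := List.length_pos_iff.2 hl
  have hdom : ∀ C, Reaches (TM0.step M) (TM0.init l) C → TM0.step M C = none →
      (eval (TM0.step M) (TM0.init l)).Dom := fun C h1 h2 =>
    Part.dom_iff_mem.2 ⟨C, mem_eval.2 ⟨h1, h2⟩⟩
  -- If the computation never halts, then all rows show successive configurations, none of them
  -- halting.
  by_contra hnd
  have hN : 0 < N := by obtain ⟨p, h1, h2, -⟩ := h.input; omega
  -- Row `i` shows a reachable configuration, with the head in column `p`.
  have row : ∀ i, i * N ≤ L → (c (i * N)).2.1 = none ∧ ∃ C p, Reaches (TM0.step M) (TM0.init l) C ∧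
      1 ≤ p ∧ p < N ∧ ∀ j : ℕ, 0 < j → j < N → i * N + j ≤ L →
        (c (i * N + j)).2.1 = cellOf C ((j : ℤ) - (p : ℕ)) := by
    intro i
    induction i with
    | zero =>
      intro _
      obtain ⟨p, h1, h2, h3⟩ := h.input
      refine ⟨by simpa using h.wall, TM0.init l, p, Relation.ReflTransGen.refl, h1, by omega, ?_⟩
      intro j hj hj2 _
      simpa using h3 j hj hj2
    | succ i ih =>
      intro hi
      have hiN : (i + 1) * N = i * N + N := by ring
      obtain ⟨hw, C, p, hC, hp1, hpN, hrow⟩ := ih (by omega)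
      have hstep : TM0.step M C = some (stepOrStay M C) := by
        cases hs : TM0.step M C with
        | none => exact absurd (hdom C hC hs) hnd
        | some C' => simp [stepOrStay, hs]
      have hw' : (c ((i + 1) * N)).2.1 = none := by
        have hb := h.below (i * N) (by omega)
        have e : c (i * N) = ((c (i * N)).1, none, (c (i * N)).2.2) := by rw [← hw]
        rw [Tile.Below, e] at hb
        rw [hiN, hb]
        rfl
      -- The neighbours shown by a tile are the actual neighbours.
      have hnb : ∀ j, 0 < j → j < N → i * N + j < L →
          (c (i * N + j)).1 = (c (i * N + (j - 1))).2.1 ∧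
          (c (i * N + j)).2.2 = (c (i * N + (j + 1))).2.1 := by
        intro j hj1 hj2 hj3
        have h1 := (h.adjacent (i * N + (j - 1)) (by omega)).1
        have h2 := (h.adjacent (i * N + j) hj3).2.1
        rw [show i * N + (j - 1) + 1 = i * N + j by omega] at h1
        exact ⟨h1, h2.symm⟩
      have hsafe := (h.adjacent (i * N + p) (by omega)).2.2
      obtain ⟨hnb1, hnb2⟩ := hnb p hp1 hpN (by omega)
      rw [Tile.Safe, hnb1, hnb2, hrow p hp1 hpN (by omega), sub_self] at hsafe
      have hp' : 1 ≤ (p : ℤ) + headShift M C ∧ (p : ℤ) + headShift M C < N := by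
        rcases headShift_cases M C with h0 | ⟨h0, h1⟩ | ⟨h0, h1⟩
        · omega
        · have : p ≠ 1 := by
            rintro rfl
            exact h1 (hsafe.1 hw)
          omega
        · have : p + 1 ≠ N := by
            intro hpe
            refine h1 (hsafe.2 ?_)
            rw [hpe, ← hiN]
            exact hw'
          omega
      refine ⟨hw', stepOrStay M C, ((p : ℤ) + headShift M C).toNat, hC.tail hstep, by omega,
        by omega, ?_⟩
      intro j hj1 hj2 hj3
      have hb := h.below (i * N + j) (by omega)
      obtain ⟨hb1, hb2⟩ := hnb j hj1 hj2 (by omega)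
      rw [Tile.Below, show c (i * N + j) = ((c (i * N + j)).1, (c (i * N + j)).2.1,
        (c (i * N + j)).2.2) from rfl, hb1, hb2, hrow j hj1 hj2 (by omega),
        nextCell_cellOf M C] at hb
      · rw [show (i + 1) * N + j = i * N + j + N by omega, hb]
        congr 1
        omega
      · by_cases hj : j = 1
        · right
          subst hj
          exact ⟨hw, by push_cast; omega⟩
        · left
          rw [hrow (j - 1) (by omega) (by omega) (by omega)]
          congr 1
          omega
      · by_cases hj : j + 1 = N
        · right
          rw [hj, ← hiN]
          exact ⟨hw', by omega⟩
        · left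
          rw [hrow (j + 1) (by omega) (by omega) (by omega)]
          congr 1
          push_cast
          omega
  have hdiv := Nat.div_add_mod' k N
  obtain ⟨hw, C, p, hC, -, -, hrow⟩ := row (k / N) (by omega)
  obtain ⟨a, q, h1, h2⟩ := hhalt
  by_cases hj : k % N = 0
  · rw [hj, add_zero] at hdiv
    rw [hdiv, h1] at hw
    simp at hw
  · have := hrow (k % N) (by omega) (Nat.mod_lt _ hN) (by omega)
    rw [hdiv, h1, cellOf] at this
    split_ifs at this with h0
    · simp only [Option.some.injEq, Prod.mk.injEq] at this
      obtain ⟨rfl, rfl⟩ := this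
      refine hnd (hdom C hC ?_)
      rw [h0, Tape.nth_zero] at h2
      obtain ⟨q, T⟩ := C
      simp [TM0.step, h2]
    · simp at this

/-- A halting computation is described by a helix with a halting tile. -/
theorem exists_isHelix {M : TM0.Machine Γ Λ} {l : List Γ}
    (h : (eval (TM0.step M) (TM0.init l)).Dom) :
    ∃ N L c, 0 < N ∧ IsHelix M l N L c ∧ ∃ k ≤ L, (c k).Halting M := by
  obtain ⟨C, hr, hC⟩ : ∃ C, Reaches (TM0.step M) (TM0.init l) C ∧ TM0.step M C = none := by
    obtain ⟨C, hC⟩ := Part.dom_iff_mem.1 h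
    exact ⟨C, mem_eval.1 hC⟩
  obtain ⟨s, hs⟩ : ∃ s, (stepOrStay M)^[s] (TM0.init l) = C := by
    clear hC
    induction hr with
    | refl => exact ⟨0, rfl⟩
    | tail _ h2 ih =>
      obtain ⟨s, rfl⟩ := ih
      refine ⟨s + 1, ?_⟩
      rw [Function.iterate_succ_apply', stepOrStay, Option.mem_def.1 h2, Option.getD_some]
  set cfg : ℕ → TM0.Cfg Γ Λ := fun i => (stepOrStay M)^[i] (TM0.init l) with hcfg
  have hcfgs : ∀ i, cfg (i + 1) = stepOrStay M (cfg i) := fun i =>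
    Function.iterate_succ_apply' _ _ _
  -- The head starts in column `s + 1`, so it stays within the row for `s` steps.
  let pos : ℕ → ℤ := fun i => Nat.rec (s + 1 : ℤ) (fun i p => p + headShift M (cfg i)) i
  have hpos : ∀ i, pos (i + 1) = pos i + headShift M (cfg i) := fun i => rfl
  have hbound : ∀ i : ℕ, (s : ℤ) + 1 - i ≤ pos i ∧ pos i ≤ (s : ℤ) + 1 + i := by
    intro i
    induction i with
    | zero => simp [pos]
    | succ i ih =>
      rw [hpos]
      rcases headShift_cases M (cfg i) with h0 | ⟨h0, -⟩ | ⟨h0, -⟩ <;> rw [h0] <;> push_cast <;>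
        omega
  obtain ⟨N, hN⟩ : ∃ N, N = s + 1 + l.length + s + 1 := ⟨_, rfl⟩
  -- Row `i` shows the `i`-th configuration between two walls, and the word ends in row `s`, before
  -- the next wall.
  set y : ℕ → Cell Γ Λ := fun k =>
    if k % N = 0 then none else cellOf (cfg (k / N)) ((k % N : ℕ) - pos (k / N)) with hy
  have hy0 : ∀ i, y (i * N) = none := fun i => by simp [hy]
  have hy1 : ∀ i j, 0 < j → j < N → y (i * N + j) = cellOf (cfg i) ((j : ℤ) - pos i) := by
    intro i j hj1 hj2
    have e1 : (i * N + j) % N = j := by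
      rw [add_comm, Nat.add_mul_mod_self_right, Nat.mod_eq_of_lt hj2]
    have e2 : (i * N + j) / N = i := by
      rw [add_comm, Nat.add_mul_div_right _ _ (by omega), Nat.div_eq_of_lt hj2, zero_add]
    simp only [hy, e1, e2, if_neg hj1.ne']
  have hsplit : ∀ k, ∃ i j, j < N ∧ k = i * N + j := fun k =>
    ⟨k / N, k % N, Nat.mod_lt _ (by omega), (Nat.div_add_mod' k N).symm⟩
  have hfinal : TM0.step M (cfg s) = none := by rw [← hs] at hC; exact hC
  have hNs : ∀ i, (i + 1) * N = i * N + N := fun i => by ring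
  refine ⟨N, s * N + (s + 1 + l.length + s), fun k =>
    (if k = 0 then none else y (k - 1), y k, y (k + 1)), by omega, ⟨?_, ?_, ?_, ?_, ?_⟩, ?_⟩
  · have := Nat.zero_le (s * N)
    omega
  · intro k hk
    obtain ⟨i, j, hj, rfl⟩ := hsplit k
    have his : i < s := by
      by_contra hge
      have := Nat.mul_le_mul_right N (not_lt.1 hge)
      omega
    simp only [Tile.Below]
    rw [show i * N + j + N = (i + 1) * N + j by rw [hNs]; omega]
    rcases Nat.eq_zero_or_pos j with rfl | hj0
    · rw [add_zero, add_zero, hy0, hy0, nextCell]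
    · rw [hy1 i j hj0 hj, hy1 (i + 1) j hj0 hj, nextCell_cellOf M (cfg i), hcfgs, hpos]
      · congr 1
        omega
      · rw [if_neg (by omega)]
        by_cases hj1 : j = 1
        · right
          subst hj1
          refine ⟨by simpa using hy0 i, ?_⟩
          have := hbound i
          push_cast
          omega
        · left
          rw [show i * N + j - 1 = i * N + (j - 1) by omega, hy1 i (j - 1) (by omega) (by omega)]
          congr 1
          omega
      · by_cases hj1 : j + 1 = N
        · right
          rw [show i * N + j + 1 = (i + 1) * N by rw [hNs]; omega]
          refine ⟨hy0 _, ?_⟩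
          have := hbound i
          omega
        · left
          rw [show i * N + j + 1 = i * N + (j + 1) by omega, hy1 i (j + 1) (by omega) (by omega)]
          congr 1
          push_cast
          omega
  · intro k hk
    refine ⟨by simp, rfl, ?_⟩
    obtain ⟨i, j, hj, rfl⟩ := hsplit k
    have his : i ≤ s := by
      by_contra hge
      have := Nat.mul_le_mul_right N (not_le.1 hge)
      rw [Nat.succ_mul] at this
      omega
    rcases Nat.eq_zero_or_pos j with rfl | hj0
    · simp [Tile.Safe, hy0, leaving]
    have hb := hbound (i + 1)
    -- The head moves only before step `s`, so it does not reach a wall.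
    have key : (j : ℤ) = pos i → TM0.step M (cfg i) ≠ none →
        1 ≤ (j : ℤ) + headShift M (cfg i) ∧ (j : ℤ) + headShift M (cfg i) < N := by
      intro h1 h2
      have : i ≠ s := by rintro rfl; exact h2 hfinal
      rw [h1, ← hpos]
      push_cast at hb
      omega
    simp only [Tile.Safe]
    rw [if_neg (by omega), hy1 i j hj0 hj]
    constructor
    · intro hx
      by_contra hne
      obtain ⟨h1, h2, h3⟩ := leaving_cellOf_ne_none.1 hne
      have := key (by omega) h3
      rw [show i * N + j - 1 = i * N + (j - 1) by omega, hy1 i (j - 1) (by omega) (by omega)] at hx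
      simp [cellOf] at hx
    · intro hx
      by_contra hne
      obtain ⟨h1, h2, h3⟩ := leaving_cellOf_ne_none.2 hne
      have := key (by omega) h3
      rw [show i * N + j + 1 = i * N + (j + 1) by omega, hy1 i (j + 1) (by omega) (by omega)] at hx
      simp [cellOf] at hx
  · simpa using hy0 0
  · refine ⟨s + 1, by omega, by omega, fun j h1 h2 => ?_⟩
    have := hy1 0 j h1 h2
    rw [zero_mul, zero_add] at this
    simpa [pos, cfg] using this
  · have hb := hbound s
    have hp : ((pos s).toNat : ℤ) = pos s := Int.toNat_of_nonneg (by omega)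
    refine ⟨s * N + (pos s).toNat, by omega, ?_⟩
    refine ⟨(cfg s).Tape.head, (cfg s).q, ?_, ?_⟩
    · change y _ = _
      rw [hy1 s _ (by omega) (by omega), hp, sub_self]
      simp [cellOf]
    · generalize cfg s = D at hfinal ⊢
      obtain ⟨q, T⟩ := D
      simpa [TM0.step] using hfinal

end Helix

/-! ### The specification as a past formula -/

namespace Past

variable {P : Type}

/-- The `i`-th trace has an event. -/
def act (i : Fin 2) : Past P := .letter i Set.univ

def or (ψ χ : Past P) : Past P := .neg (.and (.neg ψ) (.neg χ))

def verum : Past P := .neg (.and (act 0) (.neg (act 0)))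

/-- `ψ` was satisfied at an earlier event. -/
def once (ψ : Past P) : Past P := .since verum ψ

def bigOr (l : List (Past P)) : Past P := l.foldr or (.neg verum)

/-- The first event of the second trace. -/
def firstMark : Past P := .and (act 1) (.neg (once (act 1)))

/-- The second event of the second trace, provided that it satisfies `dist`. -/
def secondMark : Past P := .and (.and (act 1) (.since (.neg (act 1)) firstMark)) .dist

/-- `ψ` was satisfied at the first event of the second trace. -/
def atFirstMark (ψ : Past P) : Past P := once (.and firstMark ψ)

variable {w : Fin 2 → TimedWord (Finset P)} {δ : ℝ≥0 → Prop} {t : ℝ≥0}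

theorem sat_act (i : Fin 2) : (act i).Sat w δ t ↔ (w i).HasTime t := by
  simp [act, Sat, TimedWord.HasTime]

theorem sat_or (ψ χ : Past P) : (or ψ χ).Sat w δ t ↔ ψ.Sat w δ t ∨ χ.Sat w δ t := by
  simp only [or, Sat]
  tauto

theorem sat_verum : (verum : Past P).Sat w δ t := by
  simp [verum, Sat]

theorem sat_once (ψ : Past P) : (once ψ).Sat w δ t ↔ ∃ s, s < t ∧ Active w s ∧ ψ.Sat w δ s := by
  simp [once, Sat, sat_verum]

theorem sat_bigOr (l : List (Past P)) : (bigOr l).Sat w δ t ↔ ∃ ψ ∈ l, ψ.Sat w δ t := by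
  induction l with
  | nil => simp [bigOr, Sat, sat_verum]
  | cons ψ l ih =>
    simp only [bigOr, List.foldr_cons, sat_or, List.exists_mem_cons_iff] at ih ⊢
    rw [ih]

theorem sat_once_act (i : Fin 2) : (once (act i)).Sat w δ t ↔ ∃ s, s < t ∧ (w i).HasTime s := by
  rw [sat_once]
  refine exists_congr fun s => and_congr_right fun _ => ?_
  rw [sat_act]
  exact and_iff_right_of_imp fun h => ⟨i, h⟩

theorem sat_firstMark : (firstMark : Past P).Sat w δ t ↔ (w 1).FirstAt t := by
  simp [firstMark, Sat, sat_act, sat_once_act, TimedWord.FirstAt]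

end Past

/-- The first two events of `ρ` are at the times `s` and `t`. -/
def TimedWord.FirstTwoAt {α : Type} (ρ : TimedWord α) (s t : ℝ≥0) : Prop :=
  ρ.FirstAt s ∧ s < t ∧ ρ.HasTime t ∧ ∀ r, s < r → r < t → ¬ ρ.HasTime r

namespace Past

variable {P : Type} {w : Fin 2 → TimedWord (Finset P)} {δ : ℝ≥0 → Prop} {t : ℝ≥0}

theorem sat_secondMark :
    (secondMark : Past P).Sat w δ t ↔ ∃ s, (w 1).FirstTwoAt s t ∧ δ t := by
  simp only [secondMark, Sat, sat_act, sat_firstMark]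
  constructor
  · rintro ⟨⟨h1, s, h2, -, h3, h4⟩, h5⟩
    exact ⟨s, ⟨h3, h2, h1, fun r hr1 hr2 hr3 => h4 r hr1 hr2 ⟨1, hr3⟩ hr3⟩, h5⟩
  · rintro ⟨s, ⟨h3, h2, h1, h4⟩, h5⟩
    exact ⟨⟨h1, s, h2, ⟨1, h3.1⟩, h3, fun r hr1 hr2 _ => h4 r hr1 hr2⟩, h5⟩

theorem sat_atFirstMark {s : ℝ≥0} (h : (w 1).FirstTwoAt s t) (ψ : Past P) :
    (atFirstMark ψ).Sat w δ t ↔ ψ.Sat w δ s := by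
  rw [atFirstMark, sat_once]
  constructor
  · rintro ⟨r, -, -, h2⟩
    rw [Sat, sat_firstMark] at h2
    rw [← h2.1.unique h.1]
    exact h2.2
  · intro h2
    refine ⟨s, h.2.1, ⟨1, h.1.1⟩, ?_⟩
    rw [Sat, sat_firstMark]
    exact ⟨h.1, h2⟩

theorem sat_secondMark_and (ψ χ : Past P) :
    (Past.and secondMark (.and ψ (atFirstMark χ))).Sat w δ t ↔
      ∃ s, (w 1).FirstTwoAt s t ∧ δ t ∧ ψ.Sat w δ t ∧ χ.Sat w δ s := by
  simp only [Sat, sat_secondMark]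
  constructor
  · rintro ⟨⟨s, h1, h2⟩, h3, h4⟩
    exact ⟨s, h1, h2, h3, (sat_atFirstMark h1 χ).1 h4⟩
  · rintro ⟨s, h1, h2, h3, h4⟩
    exact ⟨⟨s, h1, h2⟩, h3, (sat_atFirstMark h1 χ).2 h4⟩

end Past

section Specification

variable {P A : Type} (dec : Finset P → A)

/-- The events of `ρ` are at the times `τ 0 < … < τ (n - 1)`, and their labels encode
`c 0, …, c (n - 1)`. -/
structure Lists (ρ : TimedWord (Finset P)) (n : ℕ) (τ : ℕ → ℝ≥0) (c : ℕ → A) : Prop where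
  strictMono : ∀ i j, i < j → j < n → τ i < τ j
  mem_iff : ∀ (B : Set A) (t : ℝ≥0),
    (∃ σ, dec σ ∈ B ∧ (σ, t) ∈ ρ.events) ↔ ∃ k < n, τ k = t ∧ c k ∈ B

/-- The first trace has an event with a label that encodes an element of `B`. -/
def tileIn (B : Set A) : Past P := .letter 0 (dec ⁻¹' B)

/-- `ψ` was satisfied at some earlier event, and all events of the first trace since then have
labels that encode elements of `B`. -/
def sinceIn (B : Set A) (ψ : Past P) : Past P :=
  .since (Past.or (.neg (Past.act 0)) (tileIn dec B)) ψ

variable {dec} {w : Fin 2 → TimedWord (Finset P)} {δ : ℝ≥0 → Prop} {n : ℕ} {τ : ℕ → ℝ≥0}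
  {c : ℕ → A}

theorem exists_lists (dec : Finset P → A) (ρ : TimedWord (Finset P)) :
    ∃ n τ c, Lists dec ρ n τ c := by
  refine ⟨ρ.events.length, fun k => (ρ.events.getD k (∅, 0)).2,
    fun k => dec (ρ.events.getD k (∅, 0)).1, ?_, ?_⟩
  · intro i j hij hj
    have := List.pairwise_iff_getElem.1 ρ.increasing i j (hij.trans hj) hj hij
    simpa [List.getElem?_eq_getElem hj, List.getElem?_eq_getElem (hij.trans hj)] using this
  · intro B t
    constructor
    · rintro ⟨σ, h1, h2⟩
      obtain ⟨k, hk, h3⟩ := List.mem_iff_getElem.1 h2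
      exact ⟨k, hk, by simp [List.getElem?_eq_getElem hk, h3],
        by simpa [List.getElem?_eq_getElem hk, h3] using h1⟩
    · rintro ⟨k, hk, h1, h2⟩
      rw [List.getD_eq_getElem _ _ hk] at h1 h2
      exact ⟨_, h2, h1 ▸ List.getElem_mem hk⟩

theorem Lists.hasTime_iff {ρ : TimedWord (Finset P)} (h : Lists dec ρ n τ c) {t : ℝ≥0} :
    ρ.HasTime t ↔ ∃ k < n, τ k = t := by
  simpa [TimedWord.HasTime] using h.mem_iff Set.univ t

theorem Lists.lt_iff {ρ : TimedWord (Finset P)} (h : Lists dec ρ n τ c) {i j : ℕ} (hi : i < n)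
    (hj : j < n) : τ i < τ j ↔ i < j := by
  refine ⟨fun hlt => ?_, fun hlt => h.strictMono i j hlt hj⟩
  by_contra hge
  rcases (not_lt.1 hge).eq_or_lt with rfl | hlt'
  · exact lt_irrefl _ hlt
  · exact lt_asymm hlt (h.strictMono j i hlt' hi)

theorem Lists.eq_iff {ρ : TimedWord (Finset P)} (h : Lists dec ρ n τ c) {i j : ℕ} (hi : i < n)
    (hj : j < n) : τ i = τ j ↔ i = j := by
  refine ⟨fun he => ?_, fun he => he ▸ rfl⟩
  rcases lt_trichotomy i j with hlt | heq | hlt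
  · exact absurd he (h.strictMono i j hlt hj).ne
  · exact heq
  · exact absurd he (h.strictMono j i hlt hi).ne'

theorem sat_tileIn (h : Lists dec (w 0) n τ c) (B : Set A) {t : ℝ≥0} :
    (tileIn dec B).Sat w δ t ↔ ∃ k < n, τ k = t ∧ c k ∈ B :=
  h.mem_iff B t

theorem sat_tileIn_time (h : Lists dec (w 0) n τ c) (B : Set A) {k : ℕ} (hk : k < n) :
    (tileIn dec B).Sat w δ (τ k) ↔ c k ∈ B := by
  rw [sat_tileIn h]
  constructor
  · rintro ⟨k', hk', h1, h2⟩
    rwa [(h.eq_iff hk' hk).1 h1] at h2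
  · exact fun h1 => ⟨k, hk, rfl, h1⟩

theorem sat_sinceIn (h : Lists dec (w 0) n τ c) (B : Set A) (ψ : Past P)
    (hψ : ∀ s, ψ.Sat w δ s → (w 0).HasTime s) {t : ℝ≥0} :
    (sinceIn dec B ψ).Sat w δ t ↔ ∃ k < n, τ k < t ∧ ψ.Sat w δ (τ k) ∧
      ∀ j, k < j → j < n → τ j < t → c j ∈ B := by
  simp only [sinceIn, Past.Sat, Past.sat_or, Past.sat_act]
  constructor
  · rintro ⟨s, h1, -, h3, h4⟩
    obtain ⟨k, hk, rfl⟩ := h.hasTime_iff.1 (hψ s h3)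
    refine ⟨k, hk, h1, h3, fun j hkj hj hjt => ?_⟩
    have hact := h.hasTime_iff.2 ⟨j, hj, rfl⟩
    rcases h4 (τ j) (h.strictMono k j hkj hj) hjt ⟨0, hact⟩ with h5 | h5
    · exact absurd hact h5
    · exact (sat_tileIn_time h B hj).1 h5
  · rintro ⟨k, hk, h1, h3, h4⟩
    refine ⟨τ k, h1, ⟨0, h.hasTime_iff.2 ⟨k, hk, rfl⟩⟩, h3, fun r hr1 hr2 _ => ?_⟩
    by_cases hact : (w 0).HasTime r
    · obtain ⟨j, hj, rfl⟩ := h.hasTime_iff.1 hact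
      exact Or.inr ((sat_tileIn_time h B hj).2 (h4 j ((h.lt_iff hk hj).1 hr1) hj hr2))
    · exact Or.inl hact

end Specification

theorem sat_first {P Γ Λ : Type} {dec : Finset P → Tile Γ Λ} {w : Fin 2 → TimedWord (Finset P)}
    {δ : ℝ≥0 → Prop} {n : ℕ} {τ : ℕ → ℝ≥0} {c : ℕ → Tile Γ Λ}
    (h : Lists dec (w 0) n τ c) {t : ℝ≥0} :
    (Past.and (.act 0) (.neg (.once (.act 0)))).Sat w δ t ↔ 0 < n ∧ τ 0 = t := by
  simp only [Past.Sat, Past.sat_act, Past.sat_once_act, h.hasTime_iff]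
  constructor
  · rintro ⟨⟨k, hk, rfl⟩, h2⟩
    refine ⟨by omega, ?_⟩
    rcases Nat.eq_zero_or_pos k with rfl | hk0
    · rfl
    · exact absurd ⟨τ 0, h.strictMono 0 k hk0 hk, 0, by omega, rfl⟩ h2
  · rintro ⟨hn, rfl⟩
    refine ⟨⟨0, hn, rfl⟩, ?_⟩
    rintro ⟨_, h1, k, hk, rfl⟩
    exact absurd ((h.lt_iff hk hn).1 h1) (by omega)

section HelixFormula

variable {Γ Λ : Type} [Inhabited Γ] [Inhabited Λ]

/-- The cell at position `m` relative to the head in the initial configuration on input `l`. -/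
def inputCell (Λ : Type) [Inhabited Λ] (l : List Γ) (m : ℤ) : Cell Γ Λ :=
  some (if 0 ≤ m then l.getI m.toNat else default, if m = 0 then some default else none)

theorem cellOf_init (l : List Γ) (m : ℤ) : cellOf (TM0.init l) m = inputCell Λ l m := by
  have h : (Tape.mk₁ l).nth m = if 0 ≤ m then l.getI m.toNat else default := by
    rw [Tape.mk₁, Tape.mk₂]
    cases m with
    | ofNat n =>
      rw [if_pos (by simp)]
      exact (Tape.mk'_nth_nat _ _ _).trans (ListBlank.nth_mk _ _)
    | negSucc n =>
      rw [if_neg (by simp)]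
      change (ListBlank.mk ([] : List Γ)).nth n = default
      rw [ListBlank.nth_mk, List.getI_nil]
  rw [cellOf, inputCell, TM0.init, h]

theorem inputCell_of_neg (l : List Γ) {m : ℤ} (h : m < 0) :
    inputCell Λ l m = some (default, none) := by
  rw [inputCell, if_neg (by omega), if_neg (by omega)]

theorem inputCell_of_length_le (l : List Γ) {m : ℤ} (h : l.length ≤ m) (hm : m ≠ 0) :
    inputCell Λ l m = some (default, none) := by
  rw [inputCell, if_neg hm, List.getI_eq_default _ (by omega)]
  simp

theorem inputCell_append (l l' : List Γ) {m : ℤ} (h : m < l.length) :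
    inputCell Λ (l ++ l') m = inputCell Λ l m := by
  rw [inputCell, inputCell]
  split_ifs <;> first | rfl | rw [List.getI_append _ _ _ (by omega)]

theorem inputCell_append_length (l : List Γ) (u : Γ) (h : l ≠ []) :
    inputCell Λ (l ++ [u]) l.length = some (u, none) := by
  have : (l.length : ℤ) ≠ 0 := by simpa using h
  rw [inputCell, if_neg this, if_pos (by omega), Int.toNat_natCast,
    List.getI_append_right _ _ _ le_rfl]
  simp

variable {P : Type} (dec : Finset P → Tile Γ Λ) (M : TM0.Machine Γ Λ)

/-- The tiles that show the cell `x` in the middle. -/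
def showing (x : Cell Γ Λ) : Set (Tile Γ Λ) := {b | b.2.1 = x}

/-- The first trace begins with a wall and blank cells up to the current event, which is the
initial position of the head, on the symbol `a`. -/
def inputStart (a : Γ) : Past P :=
  .and (tileIn dec (showing (some (a, some default))))
    (sinceIn dec (showing (some (default, none)))
      (.and (tileIn dec (showing none)) (.neg (.once (.act 0)))))

/-- The first trace begins with a wall, blank cells, and the input `a :: us`, which ends at the
current event. -/
def inputRun (a : Γ) (us : List Γ) : Past P :=
  us.foldl (fun χ u => .and (tileIn dec (showing (some (u, none)))) (sinceIn dec ∅ χ))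
    (inputStart dec a)

/-- The marks are at `t - 1` and `t`, the first trace has an event at `t`, and it has an event
before `t - 1`, but none at `t - 1`. -/
def missingAbove : Past P :=
  .and .secondMark (.and (.act 0) (.atFirstMark (.and (.neg (.act 0)) (.once (.act 0)))))

/-- The marks were at `s` and `s + 1`, the first trace had an event at `s`, but none at `s + 1`,
although it has not ended by then. -/
def missingBelow : Past P :=
  .and (.act 0) (.once (.and .secondMark (.and (.neg (.act 0)) (.atFirstMark (.act 0)))))

/-- The letters of the first trace at the two marks do not fit. -/
noncomputable def wrongBelow (tiles : List (Tile Γ Λ)) : Past P :=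
  .bigOr (tiles.map fun a =>
    .and .secondMark (.and (tileIn dec {b | ¬ a.Below M b}) (.atFirstMark (tileIn dec {a}))))

/-- The last two letters of the first trace do not fit. -/
noncomputable def wrongAdjacent (tiles : List (Tile Γ Λ)) : Past P :=
  .bigOr (tiles.map fun a =>
    .and (tileIn dec {b | ¬ a.Adjacent M b}) (sinceIn dec ∅ (tileIn dec {a})))

/-- The first mark is at the beginning of the first trace, and the part of the first trace before
the second mark does not show the initial configuration on the input described by `χ`. -/
def wrongInput (χ : Past P) : Past P :=
  .and .secondMark (.and (.neg (sinceIn dec (showing (some (default, none))) χ))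
    (.atFirstMark (.and (.act 0) (.neg (.once (.act 0))))))

/-- The first trace is not a helix, for a reason visible at the current event. -/
noncomputable def defect (tiles : List (Tile Γ Λ)) (χ : Past P) : Past P :=
  .or (wrongInput dec χ) (.or missingAbove (.or missingBelow
    (.or (wrongBelow dec M tiles) (wrongAdjacent dec M tiles))))

/-- What the absence of defects says about marks at the times `s` and `t`, if the first trace is
given by `n`, `τ` and `c`. -/
structure MarkOK (a : Γ) (us : List Γ) (n : ℕ) (τ : ℕ → ℝ≥0) (c : ℕ → Tile Γ Λ) (s t : ℝ≥0) :
    Prop where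
  above : (∃ k < n, τ k = t) → (∃ k < n, τ k < s) → ∃ k < n, τ k = s
  extends_below : (∃ k < n, τ k = s) → (∃ k < n, t < τ k) → ∃ k < n, τ k = t
  below : ∀ i < n, ∀ j < n, τ i = s → τ j = t → (c i).Below M (c j)
  input : 0 < n → τ 0 = s → ∃ p, 1 ≤ p ∧ p + us.length < n ∧ τ (p + us.length) < t ∧
    (c 0).2.1 = none ∧
    ∀ j, 0 < j → j < n → τ j < t → (c j).2.1 = inputCell Λ (a :: us) ((j : ℤ) - p)

variable {dec M} {w : Fin 2 → TimedWord (Finset P)} {δ : ℝ≥0 → Prop} {n : ℕ} {τ : ℕ → ℝ≥0}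
  {c : ℕ → Tile Γ Λ}

theorem sat_inputRun (h : Lists dec (w 0) n τ c) (a : Γ) (us : List Γ) (t : ℝ≥0) :
    (inputRun dec a us).Sat w δ t ↔ ∃ p, 1 ≤ p ∧ p + us.length < n ∧ τ (p + us.length) = t ∧
      (c 0).2.1 = none ∧
      ∀ j, 0 < j → j ≤ p + us.length → (c j).2.1 = inputCell Λ (a :: us) ((j : ℤ) - p) := by
  induction us using List.reverseRecOn generalizing t with
  | nil =>
    have hψ : ∀ s, (Past.and (tileIn dec (showing none)) (.neg (.once (.act 0)))).Sat w δ s →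
        (w 0).HasTime s := by
      intro s hs
      obtain ⟨k, hk, rfl, -⟩ := (sat_tileIn h _).1 hs.1
      exact h.hasTime_iff.2 ⟨k, hk, rfl⟩
    have hψ2 : ∀ k < n,
        (Past.and (tileIn dec (showing none)) (.neg (.once (.act 0)))).Sat w δ (τ k) ↔
        k = 0 ∧ (c 0).2.1 = none := by
      intro k hk
      have h1 := sat_first (δ := δ) h (t := τ k)
      simp only [Past.Sat, Past.sat_act] at h1 ⊢
      rw [sat_tileIn_time h _ hk]
      have h2 : (w 0).HasTime (τ k) := h.hasTime_iff.2 ⟨k, hk, rfl⟩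
      simp only [h2, true_and] at h1
      rw [h1, h.eq_iff (by omega) hk]
      constructor
      · rintro ⟨h3, -, rfl⟩
        exact ⟨rfl, h3⟩
      · rintro ⟨rfl, h3⟩
        exact ⟨h3, hk, rfl⟩
    simp only [inputRun, List.foldl_nil, inputStart, List.length_nil, add_zero]
    rw [Past.Sat, sat_tileIn h, sat_sinceIn h _ _ hψ]
    constructor
    · rintro ⟨⟨p, hp, rfl, hp2⟩, k, hk, hkp, hk2, hk3⟩
      obtain ⟨rfl, hc0⟩ := (hψ2 k hk).1 hk2
      rw [h.lt_iff hk hp] at hkp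
      refine ⟨p, hkp, hp, rfl, hc0, fun j hj1 hj2 => ?_⟩
      rcases hj2.eq_or_lt with rfl | hj2
      · rw [sub_self]
        exact hp2
      · rw [inputCell_of_neg _ (by omega)]
        exact hk3 j hj1 (by omega) (h.strictMono j p hj2 hp)
    · rintro ⟨p, hp1, hp, rfl, hc0, hc⟩
      refine ⟨⟨p, hp, rfl, ?_⟩, 0, by omega, h.strictMono 0 p hp1 hp,
        (hψ2 0 (by omega)).2 ⟨rfl, hc0⟩, fun j hj1 hj2 hj3 => ?_⟩
      · have := hc p hp1 le_rfl
        rwa [sub_self] at this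
      · rw [h.lt_iff hj2 hp] at hj3
        have := hc j hj1 hj3.le
        rwa [inputCell_of_neg _ (by omega)] at this
  | append_singleton us u ih =>
    have hlast : inputCell Λ (a :: (us ++ [u])) ((us.length + 1 : ℕ) : ℤ) = some (u, none) :=
      inputCell_append_length (a :: us) u (by simp)
    have hψ : ∀ s, (inputRun dec a us).Sat w δ s → (w 0).HasTime s := by
      intro s hs
      obtain ⟨p, -, h2, h3, -⟩ := (ih s).1 hs
      exact h.hasTime_iff.2 ⟨_, h2, h3⟩
    have e : inputRun dec a (us ++ [u]) =
        .and (tileIn dec (showing (some (u, none)))) (sinceIn dec ∅ (inputRun dec a us)) := by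
      simp [inputRun, List.foldl_append]
    rw [e, Past.Sat, sat_tileIn h, sat_sinceIn h _ _ hψ]
    simp only [List.length_append, List.length_singleton]
    constructor
    · rintro ⟨⟨i, hi, rfl, hi2⟩, k, hk, hki, hk2, hk3⟩
      obtain ⟨p, hp1, hp2, hp3, hc0, hc⟩ := (ih _).1 hk2
      obtain rfl := (h.eq_iff hp2 hk).1 hp3
      rw [h.lt_iff hk hi] at hki
      obtain rfl : i = p + us.length + 1 := by
        by_contra hne
        exact hk3 (p + us.length + 1) (by omega) (by omega) (h.strictMono _ _ (by omega) hi)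
      refine ⟨p, hp1, hi, rfl, hc0, fun j hj1 hj2 => ?_⟩
      rcases Nat.lt_or_ge (p + us.length) j with hlt | hge
      · obtain rfl : j = p + us.length + 1 := by omega
        have e1 : ((p + us.length + 1 : ℕ) : ℤ) - p = ((us.length + 1 : ℕ) : ℤ) := by
          push_cast; ring
        rw [e1, hlast]
        exact hi2
      · have hm : (j : ℤ) - p < (a :: us).length := by rw [List.length_cons]; omega
        exact (hc j hj1 hge).trans (inputCell_append (a :: us) [u] hm).symm
    · rintro ⟨p, hp1, hp2, rfl, hc0, hc⟩
      refine ⟨⟨p + (us.length + 1), hp2, rfl, ?_⟩, p + us.length, by omega,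
        h.strictMono _ _ (by omega) hp2, (ih _).2 ⟨p, hp1, by omega, rfl, hc0, ?_⟩, ?_⟩
      · have := hc (p + (us.length + 1)) (by omega) le_rfl
        have e1 : ((p + (us.length + 1) : ℕ) : ℤ) - p = ((us.length + 1 : ℕ) : ℤ) := by
          push_cast; ring
        rwa [e1, hlast] at this
      · intro j hj1 hj2
        have hm : (j : ℤ) - p < (a :: us).length := by rw [List.length_cons]; omega
        exact (hc j hj1 (by omega)).trans (inputCell_append (a :: us) [u] hm)
      · intro j hj1 hj2 hj3
        rw [h.lt_iff hj2 hp2] at hj3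
        omega

theorem sat_sinceIn_inputRun (h : Lists dec (w 0) n τ c) (a : Γ) (us : List Γ) (t : ℝ≥0) :
    (sinceIn dec (showing (some (default, none))) (inputRun dec a us)).Sat w δ t ↔
      ∃ p, 1 ≤ p ∧ p + us.length < n ∧ τ (p + us.length) < t ∧ (c 0).2.1 = none ∧
      ∀ j, 0 < j → j < n → τ j < t → (c j).2.1 = inputCell Λ (a :: us) ((j : ℤ) - p) := by
  rw [sat_sinceIn h]
  · constructor
    · rintro ⟨k, hk, hkt, hk2, hk3⟩
      obtain ⟨p, hp1, hp2, hp3, hc0, hc⟩ := (sat_inputRun h a us _).1 hk2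
      obtain rfl := (h.eq_iff hp2 hk).1 hp3
      refine ⟨p, hp1, hp2, hkt, hc0, fun j hj1 hj2 hj3 => ?_⟩
      rcases Nat.lt_or_ge (p + us.length) j with hlt | hge
      · rw [inputCell_of_length_le _ (by rw [List.length_cons]; omega) (by omega)]
        exact hk3 j hlt hj2 hj3
      · exact hc j hj1 hge
    · rintro ⟨p, hp1, hp2, hkt, hc0, hc⟩
      refine ⟨p + us.length, hp2, hkt, (sat_inputRun h a us _).2
        ⟨p, hp1, hp2, rfl, hc0, fun j hj1 hj2 => hc j hj1 (by omega) ?_⟩, fun j hj1 hj2 hj3 => ?_⟩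
      · refine lt_of_le_of_lt ?_ hkt
        rcases hj2.eq_or_lt with rfl | hlt
        · exact le_rfl
        · exact (h.strictMono _ _ hlt hp2).le
      · have := hc j (by omega) hj2 hj3
        rwa [inputCell_of_length_le _ (by rw [List.length_cons]; omega) (by omega)] at this
  · intro s hs
    obtain ⟨p, -, h2, h3, -⟩ := (sat_inputRun h a us s).1 hs
    exact h.hasTime_iff.2 ⟨_, h2, h3⟩

/-- Defects are sound and complete: they are absent if and only if the first trace respects the
rules at the two marks, provided that `dist` holds at the second mark, and adjacent tiles fit. -/
theorem not_defect_iff (h : Lists dec (w 0) n τ c) {tiles : List (Tile Γ Λ)}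
    (htiles : ∀ b, b ∈ tiles) (a : Γ) (us : List Γ) :
    (∀ t, Active w t → ¬ (defect dec M tiles (inputRun dec a us)).Sat w δ t) ↔
      (∀ s t, (w 1).FirstTwoAt s t → δ t → MarkOK M a us n τ c s t) ∧
      ∀ k, k + 1 < n → (c k).Adjacent M (c (k + 1)) := by
  simp only [defect, Past.sat_or]
  constructor
  · intro H
    refine ⟨fun s t hst hδ => ⟨fun h1 h2 => ?_, fun h1 h2 => ?_, fun i hi j hj h1 h2 => ?_,
      fun h1 h2 => ?_⟩, fun k hk => ?_⟩
    · by_contra h3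
      refine H t ⟨1, hst.2.2.1⟩ (Or.inr (Or.inl ?_))
      refine (Past.sat_secondMark_and _ _).2 ⟨s, hst, hδ, ?_⟩
      obtain ⟨k, hk, hks⟩ := h2
      simp only [Past.Sat, Past.sat_act, Past.sat_once_act, h.hasTime_iff]
      exact ⟨h1, h3, τ k, hks, k, hk, rfl⟩
    · by_contra h3
      obtain ⟨k, hk, hkt⟩ := h2
      refine H (τ k) ⟨0, h.hasTime_iff.2 ⟨k, hk, rfl⟩⟩ (Or.inr (Or.inr (Or.inl ?_)))
      rw [missingBelow, Past.Sat, Past.sat_act, Past.sat_once]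
      refine ⟨h.hasTime_iff.2 ⟨k, hk, rfl⟩, t, hkt, ⟨1, hst.2.2.1⟩,
        (Past.sat_secondMark_and _ _).2 ⟨s, hst, hδ, ?_⟩⟩
      simp only [Past.Sat, Past.sat_act, h.hasTime_iff]
      exact ⟨h3, h1⟩
    · by_contra h3
      refine H t ⟨1, hst.2.2.1⟩ (Or.inr (Or.inr (Or.inr (Or.inl ?_))))
      rw [wrongBelow, Past.sat_bigOr]
      refine ⟨_, List.mem_map_of_mem (htiles (c i)),
        (Past.sat_secondMark_and _ _).2 ⟨s, hst, hδ, ?_, ?_⟩⟩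
      · exact (sat_tileIn h _).2 ⟨j, hj, h2, h3⟩
      · exact (sat_tileIn h _).2 ⟨i, hi, h1, rfl⟩
    · by_contra h3
      refine H t ⟨1, hst.2.2.1⟩ (Or.inl ?_)
      refine (Past.sat_secondMark_and _ _).2 ⟨s, hst, hδ, ?_, (sat_first h).2 ⟨h1, h2⟩⟩
      rw [Past.Sat, sat_sinceIn_inputRun h]
      exact h3
    · by_contra h3
      refine H (τ (k + 1)) ⟨0, h.hasTime_iff.2 ⟨k + 1, hk, rfl⟩⟩
        (Or.inr (Or.inr (Or.inr (Or.inr ?_))))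
      rw [wrongAdjacent, Past.sat_bigOr]
      refine ⟨_, List.mem_map_of_mem (htiles (c k)), (sat_tileIn_time h _ hk).2 h3, ?_⟩
      rw [sat_sinceIn h]
      · refine ⟨k, by omega, h.strictMono _ _ (by omega) hk,
          (sat_tileIn_time h _ (by omega)).2 rfl, fun j hj1 hj2 hj3 => ?_⟩
        rw [h.lt_iff hj2 hk] at hj3
        omega
      · intro s hs
        obtain ⟨i, hi, h4, -⟩ := (sat_tileIn h _).1 hs
        exact h.hasTime_iff.2 ⟨i, hi, h4⟩
  · rintro ⟨H, Hadj⟩ t -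
    rintro (hb | hb | hb | hb | hb)
    · obtain ⟨s, hst, hδ, h1, h2⟩ := (Past.sat_secondMark_and _ _).1 hb
      obtain ⟨h3, h4⟩ := (sat_first h).1 h2
      rw [Past.Sat, sat_sinceIn_inputRun h] at h1
      exact h1 ((H s t hst hδ).input h3 h4)
    · obtain ⟨s, hst, hδ, h1, h2⟩ := (Past.sat_secondMark_and _ _).1 hb
      simp only [Past.Sat, Past.sat_act, Past.sat_once_act, h.hasTime_iff] at h1 h2
      obtain ⟨h2, _, h3, k, hk, rfl⟩ := h2
      exact h2 ((H s t hst hδ).above h1 ⟨k, hk, h3⟩)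
    · rw [missingBelow, Past.Sat, Past.sat_act, Past.sat_once, h.hasTime_iff] at hb
      obtain ⟨⟨k, hk, rfl⟩, t', ht', -, hb⟩ := hb
      obtain ⟨s, hst, hδ, h1, h2⟩ := (Past.sat_secondMark_and _ _).1 hb
      simp only [Past.Sat, Past.sat_act, h.hasTime_iff] at h1 h2
      exact h1 ((H s t' hst hδ).extends_below h2 ⟨k, hk, ht'⟩)
    · rw [wrongBelow, Past.sat_bigOr] at hb
      obtain ⟨_, hmem, hb⟩ := hb
      obtain ⟨b, -, rfl⟩ := List.mem_map.1 hmem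
      obtain ⟨s, hst, hδ, h1, h2⟩ := (Past.sat_secondMark_and _ _).1 hb
      obtain ⟨j, hj, hj2, hj3⟩ := (sat_tileIn h _).1 h1
      obtain ⟨i, hi, hi2, rfl⟩ := (sat_tileIn h _).1 h2
      exact hj3 ((H s t hst hδ).below i hi j hj hi2 hj2)
    · rw [wrongAdjacent, Past.sat_bigOr] at hb
      obtain ⟨_, hmem, hb⟩ := hb
      obtain ⟨b, -, rfl⟩ := List.mem_map.1 hmem
      obtain ⟨h1, h2⟩ := hb
      obtain ⟨j, hj, rfl, hj3⟩ := (sat_tileIn h _).1 h1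
      rw [sat_sinceIn h] at h2
      · obtain ⟨i, hi, hij, hi2, hi3⟩ := h2
        obtain rfl : c i = b := (sat_tileIn_time h _ hi).1 hi2
        rw [h.lt_iff hi hj] at hij
        obtain rfl : j = i + 1 := by
          by_contra hne
          exact hi3 (i + 1) (by omega) (by omega) (h.strictMono _ _ (by omega) hj)
        exact hj3 (Hadj i hj)
      · intro s hs
        obtain ⟨i, hi, h4, -⟩ := (sat_tileIn h _).1 hs
        exact h.hasTime_iff.2 ⟨i, hi, h4⟩

end HelixFormula

/-! ### Time distance one winds a word up into a helix -/

section Geometry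

variable {Γ Λ : Type} [Inhabited Γ] [Inhabited Λ] {M : TM0.Machine Γ Λ} {a : Γ} {us : List Γ}

/-- A word in which every pair of times at distance one respects the rules is a helix whose row
length is the number of events in the first time unit. -/
theorem dom_of_markOK {n : ℕ} {τ : ℕ → ℝ≥0} {c : ℕ → Tile Γ Λ}
    (hτ : ∀ i j, i < j → j < n → τ i < τ j) (hmark : ∀ s, MarkOK M a us n τ c s (s + 1))
    (hadj : ∀ k, k + 1 < n → (c k).Adjacent M (c (k + 1))) {k : ℕ} (hk : k < n)
    (hhalt : (c k).Halting M) : (eval (TM0.step M) (TM0.init (a :: us))).Dom := by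
  have hle : ∀ i j, i ≤ j → j < n → τ i ≤ τ j := fun i j hij hj => by
    rcases hij.eq_or_lt with rfl | hlt
    · exact le_rfl
    · exact (hτ i j hlt hj).le
  have hlt : ∀ i j, i < n → τ i < τ j → i < j := fun i j hi h =>
    not_le.1 fun h2 => not_le.2 h (hle j i h2 hi)
  -- `N` is the number of events in the first time unit.
  obtain ⟨N, hN, hNlt, hNle⟩ : ∃ N ≤ n, (∀ j < N, τ j < τ 0 + 1) ∧ (N < n → τ 0 + 1 ≤ τ N) := by
    classical
    have hex : ∃ N, N = n ∨ τ 0 + 1 ≤ τ N := ⟨n, Or.inl rfl⟩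
    refine ⟨Nat.find hex, Nat.find_min' hex (Or.inl rfl), fun j hj => ?_, fun h => ?_⟩
    · exact not_le.1 (not_or.1 (Nat.find_min hex hj)).2
    · exact (Nat.find_spec hex).resolve_left h.ne
  -- The event `k + 1` has a counterpart one time unit later, and there is no event between it and
  -- the counterpart of `k`, as that would in turn need a counterpart between `k` and `k + 1`.
  have hrow : ∀ k, k + N < n → τ (k + N) = τ k + 1 := by
    intro k
    induction k with
    | zero =>
      intro h0
      rw [zero_add] at h0 ⊢
      refine le_antisymm (not_lt.1 fun hgt => ?_) (hNle h0)
      obtain ⟨j, hj, hj2⟩ := (hmark (τ 0)).extends_below ⟨0, by omega, rfl⟩ ⟨N, h0, hgt⟩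
      have hjN : j < N := hlt j N hj (hj2 ▸ hgt)
      exact (hNlt j hjN).ne hj2
    | succ k ih =>
      intro h1
      have h2 := ih (by omega)
      have h3 : τ k + 1 < τ (k + 1 + N) := h2 ▸ hτ _ _ (by omega) h1
      obtain ⟨s, hs⟩ : ∃ s, τ (k + 1 + N) = s + 1 :=
        ⟨τ (k + 1 + N) - 1, (tsub_add_cancel_of_le (le_trans le_add_self h3.le)).symm⟩
      have hks : τ k < s := by
        rw [hs] at h3
        exact lt_of_add_lt_add_right h3
      obtain ⟨j, hj, rfl⟩ := (hmark s).above ⟨_, h1, hs⟩ ⟨k, by omega, hks⟩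
      have hkj : k + 1 ≤ j := hlt k j (by omega) hks
      have h4 : τ (k + 1) ≤ τ j := hle _ _ hkj hj
      refine le_antisymm (not_lt.1 fun hgt => ?_) (by rw [hs]; gcongr)
      obtain ⟨i, hi, hi2⟩ :=
        (hmark (τ (k + 1))).extends_below ⟨k + 1, by omega, rfl⟩ ⟨_, h1, hgt⟩
      have h5 : k + N < i := by
        refine hlt _ _ (by omega) ?_
        rw [h2, hi2]
        gcongr
        exact hτ _ _ (by omega) (by omega)
      have h6 := hle (k + 1 + N) i (by omega) hi
      rw [hi2] at h6
      exact absurd hgt (not_lt.2 h6)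
  obtain ⟨p, hp1, hp2, hp3, hc0, hc⟩ := (hmark (τ 0)).input (by omega) rfl
  have hpN : p + us.length < N := by
    by_contra hge
    exact not_le.2 hp3 ((hNle (by omega)).trans (hle _ _ (by omega) hp2))
  have helix : IsHelix M (a :: us) N (n - 1) c := by
    refine ⟨by omega, fun i hi => ?_, fun i hi => hadj i (by omega), hc0, p, hp1, ?_,
      fun j hj1 hj2 => ?_⟩
    · exact (hmark (τ i)).below i (by omega) (i + N) (by omega) rfl (hrow i (by omega))
    · rw [List.length_cons]
      omega
    · rw [cellOf_init]
      exact hc j hj1 (by omega) (hNlt j hj2)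
  exact helix.dom (by simp) (k := k) (by omega) hhalt

/-- A helix, with `N` events per time unit, respects the rules at all pairs of times at distance
one. -/
theorem IsHelix.markOK {N L : ℕ} {c : ℕ → Tile Γ Λ} (h : IsHelix M (a :: us) N L c) (hN : 0 < N)
    (s : ℝ≥0) : MarkOK M a us (L + 1) (fun k => (k : ℝ≥0) / N) c s (s + 1) := by
  have hN2 : (0 : ℝ≥0) < N := by exact_mod_cast hN
  have hadd : ∀ k : ℕ, ((k + N : ℕ) : ℝ≥0) / N = (k : ℝ≥0) / N + 1 := fun k => by
    rw [Nat.cast_add, add_div, div_self hN2.ne']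
  have hlt : ∀ i j : ℕ, (i : ℝ≥0) / N < (j : ℝ≥0) / N ↔ i < j := fun i j => by
    rw [div_lt_div_iff_of_pos_right hN2, Nat.cast_lt]
  have hinj : ∀ i j : ℕ, (i : ℝ≥0) / N = (j : ℝ≥0) / N → i = j := fun i j hij => by
    rcases lt_trichotomy i j with h1 | h1 | h1
    · exact absurd hij ((hlt i j).2 h1).ne
    · exact h1
    · exact absurd hij ((hlt j i).2 h1).ne'
  refine ⟨?_, ?_, ?_, ?_⟩
  · rintro ⟨k, hk, hks⟩ -
    have hNk : N ≤ k := by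
      have h1 : (1 : ℝ≥0) ≤ (k : ℝ≥0) / N := hks ▸ le_add_self
      rw [one_le_div hN2] at h1
      exact_mod_cast h1
    obtain ⟨j, rfl⟩ := Nat.exists_eq_add_of_le' hNk
    refine ⟨j, by omega, ?_⟩
    rw [hadd] at hks
    exact add_right_cancel hks
  · rintro ⟨k, hk, rfl⟩ ⟨j, hj, hkj⟩
    rw [← hadd, hlt] at hkj
    exact ⟨k + N, by omega, hadd k⟩
  · rintro i hi j hj rfl hj2
    rw [← hadd] at hj2
    obtain rfl := hinj _ _ hj2
    exact h.below i (by omega)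
  · rintro - rfl
    obtain ⟨p, hp1, hp2, hc⟩ := h.input
    have hle := h.le_length
    rw [List.length_cons] at hp2
    have hone : ∀ j : ℕ, (j : ℝ≥0) / N < ((0 : ℕ) : ℝ≥0) / N + 1 ↔ j < N := fun j => by
      rw [← hadd, hlt, zero_add]
    refine ⟨p, hp1, by omega, (hone _).2 (by omega), h.wall, fun j hj1 _ hj3 => ?_⟩
    rw [← cellOf_init]
    exact hc j hj1 ((hone j).1 hj3)

end Geometry

section HelixWord

variable {A P : Type}

/-- The timed word of `L + 1` events with labels `enc (c 0), …, enc (c L)`, of which `N` occur in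
every time unit. -/
noncomputable def helixWord (enc : A → Finset P) {N : ℕ} (hN : 0 < N) (L : ℕ) (c : ℕ → A) :
    TimedWord (Finset P) where
  events := (List.range (L + 1)).map fun k => (enc (c k), (k : ℝ≥0) / N)
  increasing := by
    rw [List.pairwise_map]
    refine List.pairwise_lt_range.imp fun {i j} hij => ?_
    have hN2 : (0 : ℝ≥0) < N := by exact_mod_cast hN
    rw [div_lt_div_iff_of_pos_right hN2, Nat.cast_lt]
    exact hij

theorem lists_helixWord {enc : A → Finset P} {dec : Finset P → A} (hdec : ∀ b, dec (enc b) = b)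
    {N : ℕ} (hN : 0 < N) (L : ℕ) (c : ℕ → A) :
    Lists dec (helixWord enc hN L c) (L + 1) (fun k => (k : ℝ≥0) / N) c := by
  refine ⟨fun i j hij _ => ?_, fun B t => ?_⟩
  · have hN2 : (0 : ℝ≥0) < N := by exact_mod_cast hN
    rw [div_lt_div_iff_of_pos_right hN2, Nat.cast_lt]
    exact hij
  · simp only [helixWord, List.mem_map, List.mem_range, Prod.mk.injEq]
    constructor
    · rintro ⟨_, h1, k, hk, rfl, h3⟩
      exact ⟨k, hk, h3, by rwa [hdec] at h1⟩
    · rintro ⟨k, hk, h3, h1⟩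
      exact ⟨_, by rwa [hdec], k, hk, rfl, h3⟩

end HelixWord

/-! ### The specification as a closed formula -/

section Somewhere

variable {P : Type}

/-- At time `0`: the formula `ψ` holds at some event of the interleaving. -/
def QF.somewhere (ψ : QF P) : QF P := .or (.and .top ψ) (.untl Interval.univ .top ψ)

theorem QF.Exact.somewhere {a : Assignment P} {ψ : QF P} (h : ψ.Exact a) : ψ.somewhere.Exact a :=
  (QF.exact_top.and h).or (QF.exact_top.untl _ h)

theorem QF.holds_somewhere {a : Assignment P} (ψ : QF P) :
    ψ.somewhere.Holds a true 0 ↔ ∃ t, a.Active t ∧ ψ.Holds a true t := by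
  simp only [somewhere, holds_or, Holds, Interval.contains_univ, true_and, imp_self, implies_true,
    and_true]
  constructor
  · rintro (h | ⟨t, -, h⟩)
    · exact ⟨0, h⟩
    · exact ⟨t, h⟩
  · rintro ⟨t, h⟩
    rcases eq_or_lt_of_le (zero_le (a := t)) with rfl | h0
    · exact Or.inl h
    · exact Or.inr ⟨t, h0, h⟩

variable [Finite P]

/-- `ψ` is satisfied at some event, and `χ` is not satisfied at any event. -/
noncomputable def specBody (δ : QF P) (ψ χ : Past P) : QF P :=
  .and (ψ.toQF δ).somewhere (.neg (χ.toQF δ).somewhere)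

theorem exact_specBody {a : Assignment P} {δ : QF P} (hδ : δ.Exact a) (ψ χ : Past P) :
    (specBody δ ψ χ).Exact a :=
  (ψ.exact_toQF hδ).somewhere.and (χ.exact_toQF hδ).somewhere.neg

theorem holds_specBody (w : Fin 2 → TimedWord (Finset P)) {δ : QF P} {d : ℝ≥0 → Prop}
    (he : δ.Exact (pairAssignment w)) (hδ : ∀ t, δ.Holds (pairAssignment w) true t ↔ d t)
    (ψ χ : Past P) : (specBody δ ψ χ).Holds (pairAssignment w) true 0 ↔
      (∃ t, Active w t ∧ ψ.Sat w d t) ∧ ∀ t, Active w t → ¬ χ.Sat w d t := by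
  rw [specBody, QF.Holds, QF.holds_neg (χ.exact_toQF he).somewhere, QF.holds_somewhere,
    QF.holds_somewhere]
  simp only [active_pairAssignment, Past.holds_toQF w he hδ, not_exists, not_and]

end Somewhere

section Deterministic

variable {P : Type}

/-- The past formula that says at the last event what `specBody` says at time `0`. -/
def Past.summary (ψ χ : Past P) : Past P := .and (.or ψ (.once ψ)) (.neg (.or χ (.once χ)))

theorem Past.sat_or_once_of_last {w : Fin 2 → TimedWord (Finset P)} {δ : ℝ≥0 → Prop} {t : ℝ≥0}
    (ht : Active w t) (hlast : ∀ s, Active w s → s ≤ t) (ψ : Past P) :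
    (Past.or ψ (.once ψ)).Sat w δ t ↔ ∃ s, Active w s ∧ ψ.Sat w δ s := by
  rw [sat_or, sat_once]
  constructor
  · rintro (h | ⟨s, -, h⟩)
    · exact ⟨t, ht, h⟩
    · exact ⟨s, h⟩
  · rintro ⟨s, hs, h⟩
    rcases (hlast s hs).eq_or_lt with rfl | hlt
    · exact Or.inl h
    · exact Or.inr ⟨s, hlt, hs, h⟩

theorem Past.exists_last_sat_summary {ι : Type} [Fintype ι] {e : Fin 2 → ι}
    (he : Function.Surjective e) (ρ : ι → TimedWord (Finset P)) (δ : ℝ≥0 → Prop) (ψ χ : Past P) :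
    (∃ pre t, TimedWord.allTimes ρ = pre ++ [t] ∧ (summary ψ χ).Sat (ρ ∘ e) δ t) ↔
      (∃ t, Active (ρ ∘ e) t ∧ ψ.Sat (ρ ∘ e) δ t) ∧
        ∀ t, Active (ρ ∘ e) t → ¬ χ.Sat (ρ ∘ e) δ t := by
  have key : ∀ pre t, TimedWord.allTimes ρ = pre ++ [t] → ((summary ψ χ).Sat (ρ ∘ e) δ t ↔
      (∃ t, Active (ρ ∘ e) t ∧ ψ.Sat (ρ ∘ e) δ t) ∧
        ∀ t, Active (ρ ∘ e) t → ¬ χ.Sat (ρ ∘ e) δ t) := by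
    intro pre t hpt
    have ht : Active (ρ ∘ e) t := (active_comp_iff he ρ t).2 (by simp [hpt])
    have hlast : ∀ s, Active (ρ ∘ e) s → s ≤ t := by
      intro s hs
      have hp := TimedWord.pairwise_allTimes ρ
      rw [active_comp_iff he, hpt, List.mem_append, List.mem_singleton] at hs
      rw [hpt, List.pairwise_append] at hp
      rcases hs with hs | rfl
      · exact (hp.2.2 s hs t (by simp)).le
      · exact le_rfl
    simp only [summary, Sat, sat_or_once_of_last ht hlast, not_exists, not_and]
  constructor
  · rintro ⟨pre, t, hpt, h⟩
    exact (key pre t hpt).1 h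
  · intro h
    obtain ⟨t, ht, -⟩ := h.1
    rw [active_comp_iff he] at ht
    obtain ⟨pre, t, hpt⟩ :=
      (List.eq_nil_or_concat (TimedWord.allTimes ρ)).resolve_left (List.ne_nil_of_mem ht)
    rw [List.concat_eq_append] at hpt
    exact ⟨pre, t, hpt, (key pre t hpt).2 h⟩

/-- A formula with the variables `0` and `1` is deterministic if its quantifier-free part amounts
to a Boolean function of whether some event satisfies `ψ` and none satisfies `χ`. -/
theorem Formula.isDeterministic_of_past [Finite P] {φ : Formula P} (hφ : φ.boundVars = [0, 1])
    {δ : (Fin 2 → TimedWord (Finset P)) → ℝ≥0 → Prop} {c : ℕ}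
    (D : ∀ (ι : Type) [Fintype ι] (e : Fin 2 → ι), DistAutomaton e δ c) (ψ χ : Past P)
    (acc : Prop → Prop)
    (h : ∀ w, φ.body.Holds (pairAssignment w) true 0 ↔
      acc ((∃ t, Active w t ∧ ψ.Sat w (δ w) t) ∧ ∀ t, Active w t → ¬ χ.Sat w (δ w) t)) :
    φ.IsDeterministic c := by
  have hvar : ∀ n, n ∈ φ.boundVars.toFinset ↔ n < 2 := fun n => by
    rw [hφ, List.mem_toFinset, List.mem_cons, List.mem_singleton]
    omega
  let e : Fin 2 → φ.Var := fun i => ⟨i, (hvar i).2 i.2⟩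
  have he : Function.Surjective e := fun v => ⟨⟨v.1, (hvar v.1).1 v.2⟩, rfl⟩
  have hassign : ∀ ρ : φ.Var → TimedWord (Finset P), φ.assign ρ = pairAssignment (ρ ∘ e) := by
    intro ρ
    funext n
    by_cases hn : n < 2
    · simp only [Formula.assign, (hvar n).2 hn, pairAssignment, hn, dif_pos]
      rfl
    · rw [Formula.assign, dif_neg (fun h2 => hn ((hvar n).1 h2)), pairAssignment, dif_neg hn]
  obtain ⟨S, hS, B, hB, hacc⟩ := exists_timedAutomaton_of_past he (D _ e) (Past.summary ψ χ) acc
  refine ⟨S, hS, B, hB, fun ρ => ?_⟩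
  rw [hacc, hassign, h, Past.exists_last_sat_summary he]

end Deterministic

/-! ### Variables and intervals of the specification -/

section Bodies

variable {P : Type} {V : Finset ℕ}

theorem QF.vars_bigOr {l : List (QF P)} (h : ∀ ψ ∈ l, ψ.vars ⊆ V) : (bigOr l).vars ⊆ V := by
  induction l with
  | nil => simp [bigOr, bot, vars]
  | cons ψ l ih =>
    rw [List.forall_mem_cons] at h
    exact Finset.union_subset h.1 (ih h.2)

theorem QF.vars_bigAnd {l : List (QF P)} (h : ∀ ψ ∈ l, ψ.vars ⊆ V) : (bigAnd l).vars ⊆ V := by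
  induction l with
  | nil => simp [bigAnd, bot, vars]
  | cons ψ l ih =>
    rw [List.forall_mem_cons] at h
    exact Finset.union_subset h.1 (ih h.2)

theorem QF.untimed_bigOr {l : List (QF P)} (h : ∀ ψ ∈ l, ψ.Untimed) : (bigOr l).Untimed := by
  induction l with
  | nil => simp [bigOr, bot, Untimed]
  | cons ψ l ih =>
    rw [List.forall_mem_cons] at h
    exact ⟨h.1, ih h.2⟩

theorem QF.untimed_bigAnd {l : List (QF P)} (h : ∀ ψ ∈ l, ψ.Untimed) : (bigAnd l).Untimed := by
  induction l with
  | nil => simp [bigAnd, bot, Untimed]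
  | cons ψ l ih =>
    rw [List.forall_mem_cons] at h
    exact ⟨h.1, ih h.2⟩

variable [Finite P]

theorem QF.vars_letterIn (A : Set (Finset P)) (π : ℕ) : (letterIn A π).vars ⊆ {π} := by
  refine vars_bigOr fun ψ hψ => ?_
  obtain ⟨σ, -, rfl⟩ := List.mem_map.1 hψ
  refine Finset.union_subset (by simp [vars]) (vars_bigAnd fun ψ hψ => ?_)
  obtain ⟨p, -, rfl⟩ := List.mem_map.1 hψ
  split_ifs <;> simp [atomAt, vars]

theorem QF.untimed_letterIn (A : Set (Finset P)) (π : ℕ) : (letterIn A π).Untimed := by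
  refine untimed_bigOr fun ψ hψ => ?_
  obtain ⟨σ, -, rfl⟩ := List.mem_map.1 hψ
  refine ⟨trivial, untimed_bigAnd fun ψ hψ => ?_⟩
  obtain ⟨p, -, rfl⟩ := List.mem_map.1 hψ
  split_ifs <;> simp [atomAt, Untimed]

theorem Past.vars_toQF {δ : QF P} (h : δ.vars ⊆ {0, 1}) (ψ : Past P) :
    (ψ.toQF δ).vars ⊆ {0, 1} := by
  induction ψ with
  | letter i A =>
    refine (QF.vars_letterIn A i).trans ?_
    fin_cases i <;> simp
  | dist => exact h
  | and ψ χ h1 h2 => exact Finset.union_subset h1 h2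
  | neg ψ h1 => exact h1
  | since ψ χ h1 h2 => exact Finset.union_subset h1 h2

theorem Past.untimed_toQF {δ : QF P} (h : δ.Untimed) (ψ : Past P) : (ψ.toQF δ).Untimed := by
  induction ψ with
  | letter i A => exact QF.untimed_letterIn A i
  | dist => exact h
  | and ψ χ h1 h2 => exact ⟨h1, h2⟩
  | neg ψ h1 => exact h1
  | since ψ χ h1 h2 => exact ⟨rfl, h1, h2⟩

theorem vars_specBody {δ : QF P} (h : δ.vars ⊆ {0, 1}) (ψ χ : Past P) :
    (specBody δ ψ χ).vars ⊆ {0, 1} := by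
  simp [specBody, QF.somewhere, QF.or, QF.vars, Finset.union_subset_iff, Past.vars_toQF h]

theorem untimed_specBody {δ : QF P} (h : δ.Untimed) (ψ χ : Past P) :
    (specBody δ ψ χ).Untimed := by
  simp [specBody, QF.somewhere, QF.or, QF.Untimed, Past.untimed_toQF h]

end Bodies

section Quantified

variable {P : Type} {T : Set (TimedWord (Finset P))} (ψ : QF P)

/-- `∃ 0 ∀ 1 ψ` -/
def existsForall : Formula P := .ex 0 (.all 1 (.qf ψ))

/-- `∀ 0 ∃ 1 ¬ψ` -/
def forallExists : Formula P := .all 0 (.ex 1 (.qf (.neg ψ)))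

theorem update_eq_pairAssignment (ρ ρ' : TimedWord (Finset P)) :
    Function.update (Function.update (fun _ => none) 0 (some ρ)) 1 (some ρ') =
      pairAssignment ![ρ, ρ'] := by
  funext n
  match n with
  | 0 => rfl
  | 1 => rfl
  | n + 2 => simp [pairAssignment, Function.update]

theorem satisfies_existsForall : (existsForall ψ).Satisfies T ↔
    ∃ ρ ∈ T, ∀ ρ' ∈ T, ψ.Holds (pairAssignment ![ρ, ρ']) true 0 := by
  simp only [existsForall, Formula.Satisfies, Formula.Holds, update_eq_pairAssignment]

theorem satisfies_forallExists (hψ : ∀ a, ψ.Exact a) :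
    (forallExists ψ).Satisfies T ↔ ¬ (existsForall ψ).Satisfies T := by
  rw [satisfies_existsForall]
  simp only [forallExists, Formula.Satisfies, Formula.Holds, update_eq_pairAssignment,
    QF.holds_neg (hψ _)]
  push Not
  rfl

theorem freeVars_existsForall (h : ψ.vars ⊆ {0, 1}) : (existsForall ψ).freeVars = ∅ := by
  ext n
  have := @h n
  simp only [Finset.mem_insert, Finset.mem_singleton] at this
  simp only [existsForall, Formula.freeVars, Finset.mem_erase, Finset.notMem_empty, iff_false]
  tauto

theorem freeVars_forallExists (h : ψ.vars ⊆ {0, 1}) : (forallExists ψ).freeVars = ∅ :=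
  freeVars_existsForall ψ h

end Quantified

/-! ### Computability of the specification -/

section Code

variable {k : ℕ} {α : Type} [Primcodable α]

/-- The code of the HyperMTL formula that expresses a past formula. -/
noncomputable def Past.code (δ : QF (Fin k)) (ψ : Past (Fin k)) : ℕ := (ψ.toQF δ).code

theorem primrec_code_and (δ : QF (Fin k)) {ψ χ : α → Past (Fin k)}
    (h1 : Primrec fun x => (ψ x).code δ) (h2 : Primrec fun x => (χ x).code δ) :
    Primrec fun x => (Past.and (ψ x) (χ x)).code δ :=
  Primrec₂.natPair.comp (.const 3) (Primrec₂.natPair.comp h1 h2)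

theorem primrec_code_neg (δ : QF (Fin k)) {ψ : α → Past (Fin k)}
    (h1 : Primrec fun x => (ψ x).code δ) : Primrec fun x => (Past.neg (ψ x)).code δ :=
  Primrec₂.natPair.comp (.const 4) h1

theorem primrec_code_since (δ : QF (Fin k)) {ψ χ : α → Past (Fin k)}
    (h1 : Primrec fun x => (ψ x).code δ) (h2 : Primrec fun x => (χ x).code δ) :
    Primrec fun x => (Past.since (ψ x) (χ x)).code δ :=
  Primrec₂.natPair.comp (.const 6) (Primrec₂.natPair.comp (.const _) (Primrec₂.natPair.comp h1 h2))

theorem primrec_code_or (δ : QF (Fin k)) {ψ χ : α → Past (Fin k)}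
    (h1 : Primrec fun x => (ψ x).code δ) (h2 : Primrec fun x => (χ x).code δ) :
    Primrec fun x => (Past.or (ψ x) (χ x)).code δ :=
  primrec_code_neg δ (primrec_code_and δ (primrec_code_neg δ h1) (primrec_code_neg δ h2))

theorem primrec_code_somewhere {ψ : α → QF (Fin k)} (h : Primrec fun x => (ψ x).code) :
    Primrec fun x => (ψ x).somewhere.code := by
  have h1 : Primrec fun x => (QF.neg (.and .top (ψ x))).code :=
    Primrec₂.natPair.comp (.const 4)
      (Primrec₂.natPair.comp (.const 3) (Primrec₂.natPair.comp (.const _) h))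
  have h2 : Primrec fun x => (QF.neg (.untl Interval.univ .top (ψ x))).code :=
    Primrec₂.natPair.comp (.const 4) (Primrec₂.natPair.comp (.const 5)
      (Primrec₂.natPair.comp (.const _) (Primrec₂.natPair.comp (.const _) h)))
  exact Primrec₂.natPair.comp (.const 4) (Primrec₂.natPair.comp (.const 3)
    (Primrec₂.natPair.comp h1 h2))

theorem primrec_code_specBody (δ : QF (Fin k)) (ψ : Past (Fin k)) {χ : α → Past (Fin k)}
    (h : Primrec fun x => (χ x).code δ) : Primrec fun x => (specBody δ ψ (χ x)).code :=
  Primrec₂.natPair.comp (.const 3) (Primrec₂.natPair.comp (.const _)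
    (Primrec₂.natPair.comp (.const 4) (primrec_code_somewhere h)))

variable {Γ Λ : Type} [Inhabited Γ] [Inhabited Λ]

theorem primrec_code_inputRun (δ : QF (Fin k)) (dec : Finset (Fin k) → Tile Γ Λ) (a : Γ)
    (g : Bool → Γ) {bits : α → List Bool} (h : Primrec bits) :
    Primrec fun x => (inputRun dec a ((bits x).map g)).code δ := by
  let fits : Bool → ℕ := fun b => (tileIn dec (showing (some (g b, none)))).code δ
  let here : Past (Fin k) := Past.or (.neg (.act 0)) (tileIn dec ∅)
  let next : ℕ → Bool → ℕ := fun y b =>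
    Nat.pair 3 (Nat.pair (fits b) (Nat.pair 6 (Nat.pair Interval.univ.code
      (Nat.pair (here.code δ) y))))
  have hfold : ∀ (bs : List Bool) (χ : Past (Fin k)),
      ((bs.map g).foldl (fun χ u => Past.and (tileIn dec (showing (some (u, none))))
        (sinceIn dec ∅ χ)) χ).code δ = bs.foldl next (χ.code δ) := by
    intro bs
    induction bs with
    | nil => exact fun χ => rfl
    | cons b bs ih => exact fun χ => ih _
  have hnext : Primrec₂ fun (_ : α) (p : ℕ × Bool) => next p.1 p.2 := by
    have h1 : Primrec fun q : α × ℕ × Bool => fits q.2.2 :=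
      (Primrec.dom_finite fits).comp (Primrec.snd.comp Primrec.snd)
    have h2 : Primrec fun q : α × ℕ × Bool => q.2.1 := Primrec.fst.comp Primrec.snd
    exact Primrec₂.natPair.comp (.const 3) (Primrec₂.natPair.comp h1 (Primrec₂.natPair.comp
      (.const 6) (Primrec₂.natPair.comp (.const _) (Primrec₂.natPair.comp (.const _) h2))))
  refine (Primrec.list_foldl h (.const ((inputStart dec a).code δ)) hnext).of_eq fun x => ?_
  exact (hfold _ _).symm

theorem primrec_code_defect (δ : QF (Fin k)) (dec : Finset (Fin k) → Tile Γ Λ)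
    (M : Turing.TM0.Machine Γ Λ) (tiles : List (Tile Γ Λ)) {χ : α → Past (Fin k)}
    (h : Primrec fun x => (χ x).code δ) :
    Primrec fun x => (defect dec M tiles (χ x)).code δ := by
  refine primrec_code_or δ ?_ (.const _)
  refine primrec_code_and δ (.const _) (primrec_code_and δ ?_ (.const _))
  exact primrec_code_neg δ (primrec_code_since δ (.const _) h)

end Code

/-! ### The models -/

section Model

variable {P : Type} {m : ℕ}

/-- The events `l` can be read from the clock valuation `v` at time `τ`. -/
def CanRead (g : Finset P → Guard (Fin m)) :
    (Fin m → ℝ≥0) → ℝ≥0 → List (Finset P × ℝ≥0) → Prop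
  | _, _, [] => True
  | v, τ, (σ, t) :: l => (g σ).Sat (fun x => v x + (t - τ)) ∧ CanRead g (fun _ => 0) t l

theorem canRead_of_forall {g : Finset P → Guard (Fin m)} {l : List (Finset P × ℝ≥0)}
    (h : ∀ e ∈ l, ∀ v, (g e.1).Sat v) (v : Fin m → ℝ≥0) (τ : ℝ≥0) : CanRead g v τ l := by
  induction l generalizing v τ with
  | nil => trivial
  | cons p l ih =>
    rw [List.forall_mem_cons] at h
    exact ⟨h.1 _, ih h.2 _ _⟩

variable [Fintype P]

/-- The automaton with one location, which is accepting, where every letter has its own guard and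
resets all clocks. -/
noncomputable def oneLocation (g : Finset P → Guard (Fin m)) :
    TimedAutomaton (Finset P) (Fin 1) (Fin m) where
  init := 0
  trans := (Finset.univ : Finset (Finset P)).toList.map fun σ => ⟨0, σ, g σ, Finset.univ, 0⟩
  final := [0]

theorem oneLocation_deterministic (g : Finset P → Guard (Fin m)) :
    (oneLocation g).Deterministic := by
  intro d hd e he hne _ hlet
  obtain ⟨σ, -, rfl⟩ := List.mem_map.1 hd
  obtain ⟨σ', -, rfl⟩ := List.mem_map.1 he
  obtain rfl : σ = σ' := hlet
  exact absurd rfl hne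

theorem mem_language_oneLocation (g : Finset P → Guard (Fin m)) (ρ : TimedWord (Finset P)) :
    ρ ∈ (oneLocation g).language ↔ CanRead g (fun _ => 0) 0 ρ.events := by
  have key : ∀ (l : List (Finset P × ℝ≥0)) (v : Fin m → ℝ≥0) (τ : ℝ≥0),
      (∃ s v', (oneLocation g).Run 0 v τ l s v' ∧ s ∈ (oneLocation g).final) ↔
        CanRead g v τ l := by
    intro l
    induction l with
    | nil =>
      intro v τ
      simp [CanRead, TimedAutomaton.run_nil_iff, oneLocation]
    | cons p l ih =>
      intro v τ
      obtain ⟨σ, t⟩ := p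
      rw [CanRead, ← ih]
      have hreset : ∀ v : Fin m → ℝ≥0,
          TimedAutomaton.resetClocks Finset.univ v = fun _ => 0 := fun v => by
        funext x
        simp [TimedAutomaton.resetClocks]
      have htrans : ∀ d, d ∈ (oneLocation g).trans ↔
          ∃ σ, (⟨0, σ, g σ, Finset.univ, 0⟩ : Transition _ _ _) = d := fun d => by
        simp [oneLocation]
      simp only [TimedAutomaton.run_cons_iff, htrans]
      constructor
      · rintro ⟨s, v', ⟨_, ⟨σ', rfl⟩, -, rfl, hg, hr⟩, hs⟩
        rw [hreset] at hr
        exact ⟨hg, s, v', hr, hs⟩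
      · rintro ⟨hg, s, v', hr, hs⟩
        refine ⟨s, v', ⟨_, ⟨σ, rfl⟩, rfl, rfl, hg, ?_⟩, hs⟩
        rw [hreset]
        exact hr
  exact key _ _ _

end Model

section Marker

variable {P : Type}

/-- The word with an unlabelled event at time `s` and an event with label `{d}` one time unit
later. -/
noncomputable def markerWord (d : P) (s : ℝ≥0) : TimedWord (Finset P) where
  events := [(∅, s), ({d}, s + 1)]
  increasing := by simp

theorem hasTime_markerWord (d : P) (s t : ℝ≥0) :
    (markerWord d s).HasTime t ↔ t = s ∨ t = s + 1 := by
  simp [TimedWord.HasTime, markerWord, exists_or]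

theorem firstTwoAt_markerWord (d : P) (s : ℝ≥0) : (markerWord d s).FirstTwoAt s (s + 1) := by
  have hlt : s < s + 1 := lt_add_one s
  refine ⟨⟨(hasTime_markerWord d s s).2 (Or.inl rfl), fun r hr h => ?_⟩, hlt,
    (hasTime_markerWord d s _).2 (Or.inr rfl), fun r hr1 hr2 h => ?_⟩
  · rcases (hasTime_markerWord d s r).1 h with rfl | rfl
    · exact lt_irrefl _ hr
    · exact lt_asymm hr hlt
  · rcases (hasTime_markerWord d s r).1 h with rfl | rfl
    · exact lt_irrefl _ hr1
    · exact lt_irrefl _ hr2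

theorem TimedWord.FirstTwoAt.events_eq {α : Type} {ρ : TimedWord α} {s t : ℝ≥0}
    (h : ρ.FirstTwoAt s t) : ∃ a b l, ρ.events = (a, s) :: (b, t) :: l := by
  obtain ⟨⟨⟨a, ha⟩, h1⟩, hst, ⟨b, hb⟩, h2⟩ := h
  obtain ⟨evs, hinc⟩ := ρ
  simp only [TimedWord.HasTime] at *
  match evs with
  | [] => simp at ha
  | [(x, r)] =>
    simp only [List.mem_singleton, Prod.mk.injEq] at ha hb
    exact absurd (ha.2.trans hb.2.symm) hst.ne
  | (x, r) :: (y, r') :: l =>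
    simp only [List.pairwise_cons, List.forall_mem_cons] at hinc
    obtain ⟨⟨hrr, hr⟩, hr', -⟩ := hinc
    have hrs : r = s := by
      by_contra hne
      rcases lt_or_gt_of_ne hne with hlt | hgt
      · exact h1 r hlt ⟨x, by simp⟩
      · simp only [List.mem_cons, Prod.mk.injEq] at ha
        rcases ha with ⟨-, rfl⟩ | ⟨-, rfl⟩ | ha
        · exact hne rfl
        · exact lt_asymm hgt hrr
        · exact lt_asymm hgt (hr _ ha)
    subst hrs
    have hrt : r' = t := by
      by_contra hne
      rcases lt_or_gt_of_ne hne with hlt | hgt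
      · exact h2 r' hrr hlt ⟨y, by simp⟩
      · simp only [List.mem_cons, Prod.mk.injEq] at hb
        rcases hb with ⟨-, rfl⟩ | ⟨-, rfl⟩ | hb
        · exact lt_irrefl _ hst
        · exact hne rfl
        · exact lt_asymm hgt (hr' _ hb)
    subst hrt
    exact ⟨x, y, l, rfl⟩

end Marker

/-! ### Measuring distance one by the model or by the specification -/

/-- A way to make sure that the first two events of the second trace are one time unit apart
whenever `dist` holds at the second one: by a model with `m` clocks and a property `dist` that
takes `c` clocks to recognize. The proposition `d` does not occur in the first trace, and may
be used to label marks. -/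
structure TimeDistance {P : Type} (d : P) (m c : ℕ) where
  model : TimedAutomaton (Finset P) (Fin 1) (Fin m)
  deterministic : model.Deterministic
  dist : (Fin 2 → TimedWord (Finset P)) → ℝ≥0 → Prop
  formula : QF P
  exact_formula : ∀ a, formula.Exact a
  holds_formula : ∀ w t, formula.Holds (pairAssignment w) true t ↔ dist w t
  vars_formula : formula.vars ⊆ {0, 1}
  automaton : ∀ (ι : Type) [Fintype ι] (e : Fin 2 → ι), DistAutomaton e dist c
  mem_of_forall_notMem : ∀ ρ : TimedWord (Finset P), (∀ e ∈ ρ.events, d ∉ e.1) →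
    ρ ∈ model.language
  markerWord_mem : ∀ s, markerWord d s ∈ model.language
  dist_markerWord : ∀ w s, w 1 = markerWord d s → dist w (s + 1)
  eq_add_one : ∀ w s t, w 1 ∈ model.language → (w 1).FirstTwoAt s t → dist w t → t = s + 1

/-- The specification measures the distance, with one clock, and the model accepts all words. -/
noncomputable def TimeDistance.bySpec {P : Type} [Fintype P] (d : P) : TimeDistance d 0 1 where
  model := oneLocation fun _ => .top
  deterministic := oneLocation_deterministic _
  dist := unitSinceFirst
  formula := unitSinceFirstQF P
  exact_formula := exact_unitSinceFirstQF
  holds_formula := holds_unitSinceFirstQF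
  vars_formula := by
    simp [unitSinceFirstQF, firstQF, QF.vars]
  automaton _ _ e := unitSinceFirstAutomaton e
  mem_of_forall_notMem ρ _ :=
    (mem_language_oneLocation _ ρ).2
      (canRead_of_forall (g := fun _ => .top) (fun _ _ _ => trivial) _ _)
  markerWord_mem s :=
    (mem_language_oneLocation _ _).2
      (canRead_of_forall (g := fun _ => .top) (fun _ _ _ => trivial) _ _)
  dist_markerWord w s h := ⟨s, h ▸ (firstTwoAt_markerWord d s).1, rfl⟩
  eq_add_one := by
    rintro w s t - h ⟨s', hs', rfl⟩
    rw [hs'.unique h.1]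

open Classical in
/-- The model measures the distance, with one clock: every event whose label contains `d` happens
one time unit after the previous event. -/
noncomputable def TimeDistance.byModel {P : Type} [Fintype P] (d : P) : TimeDistance d 1 0 where
  model := oneLocation fun σ => if d ∈ σ then .compareOne 0 .eq else .top
  deterministic := oneLocation_deterministic _
  dist := flagged d
  formula := QF.atomAt d 1
  exact_formula _ := QF.exact_atomAt d 1
  holds_formula := holds_flaggedQF d
  vars_formula := by simp [QF.atomAt, QF.vars]
  automaton _ _ e := flaggedAutomaton d e
  mem_of_forall_notMem ρ h := by
    refine (mem_language_oneLocation _ ρ).2 (canRead_of_forall (fun e he v => ?_) _ _)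
    rw [if_neg (h e he)]
    trivial
  markerWord_mem s := by
    simp [mem_language_oneLocation, markerWord, CanRead, Guard.Sat, Guard.sat_compareOne]
  dist_markerWord w s h := by
    simp [flagged, h, markerWord]
  eq_add_one := by
    rintro w s t hw h ⟨σ, hσ, hd⟩
    obtain ⟨a, b, l, hl⟩ := h.events_eq
    have hb : b = σ := (w 1).letter_unique (t := t) (by simp [hl]) hσ
    subst hb
    rw [mem_language_oneLocation, hl] at hw
    have h1 := hw.2.1
    simp only [if_pos hd, Guard.sat_compareOne, cmp_eq_eq_iff, zero_add] at h1
    rw [← h1, add_tsub_cancel_of_le h.2.1.le]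

section Reduction

variable {Γ Λ P : Type} [Inhabited Γ] [Inhabited Λ] {d : P} {m c : ℕ}
  {enc : Tile Γ Λ → Finset P} {dec : Finset P → Tile Γ Λ} {M : TM0.Machine Γ Λ}
  {tiles : List (Tile Γ Λ)}

/-- The machine halts if and only if some trace is a helix with a halting tile, where helices are
recognized by comparing them with all pairs of marks at distance one. -/
theorem TimeDistance.exists_forall_iff_dom (D : TimeDistance d m c) (hdec : ∀ b, dec (enc b) = b)
    (henc : ∀ b, d ∉ enc b) (htiles : ∀ b, b ∈ tiles) (a : Γ) (us : List Γ) :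
    (∃ ρ ∈ D.model.language, ∀ ρ' ∈ D.model.language,
      (∃ t, Active ![ρ, ρ'] t ∧
        (tileIn dec {b | b.Halting M}).Sat ![ρ, ρ'] (D.dist ![ρ, ρ']) t) ∧
      ∀ t, Active ![ρ, ρ'] t →
        ¬ (defect dec M tiles (inputRun dec a us)).Sat ![ρ, ρ'] (D.dist ![ρ, ρ']) t) ↔
    (eval (TM0.step M) (TM0.init (a :: us))).Dom := by
  constructor
  · rintro ⟨ρ, -, H⟩
    -- The marker words put marks at all pairs of times at distance one.
    obtain ⟨n, τ, c, h⟩ := exists_lists dec ρ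
    have h2 : ∀ s, _ := fun s => ((not_defect_iff h htiles a us).1
      (H _ (D.markerWord_mem s)).2).1 s (s + 1) (firstTwoAt_markerWord d s)
      (D.dist_markerWord _ s rfl)
    obtain ⟨⟨t, -, ht⟩, h3⟩ := H _ (D.markerWord_mem 0)
    obtain ⟨k, hk, -, hk2⟩ := (sat_tileIn h _).1 ht
    exact dom_of_markOK h.strictMono h2 ((not_defect_iff h htiles a us).1 h3).2 hk hk2
  · intro hdom
    -- Whatever the second trace is, its marks are at distance one if `dist` holds, and otherwise
    -- they are ignored.
    obtain ⟨N, L, c, hN, helix, k, hk, hk2⟩ := exists_isHelix hdom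
    have h := lists_helixWord hdec hN L c
    refine ⟨helixWord enc hN L c, D.mem_of_forall_notMem _ ?_, fun ρ' hρ' => ⟨?_, ?_⟩⟩
    · intro e he
      obtain ⟨k, -, rfl⟩ := List.mem_map.1 he
      exact henc _
    · exact ⟨_, ⟨0, h.hasTime_iff.2 ⟨k, by omega, rfl⟩⟩,
        (sat_tileIn (w := ![_, ρ']) h _).2 ⟨k, by omega, rfl, hk2⟩⟩
    · refine (not_defect_iff h htiles a us).2 ⟨fun s t hst hδ => ?_, fun k hk => ?_⟩
      · obtain rfl := D.eq_add_one _ s t hρ' hst hδ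
        exact helix.markOK hN s
      · exact helix.adjacent k (by omega)

end Reduction

/-! ### Undecidability -/

theorem Undecidable.mono {K K' : Set Instance} (h : Undecidable K) (hK : K ⊆ K') :
    Undecidable K' := fun ⟨f, hf, H⟩ => h ⟨f, hf, fun I hI => H I (hK hI)⟩

theorem undecidable_of_reduction {p : ℕ → Prop} (hp : ¬ ComputablePred p) {K : Set Instance}
    (I : ℕ → Instance) (hI : ∀ n, I n ∈ K) (hcode : Primrec fun n => (I n).code)
    (hyes : ∀ n, (I n).Yes ↔ p n) : Undecidable K := by
  classical
  rintro ⟨f, hf, H⟩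
  refine hp ⟨inferInstance, (hf.comp hcode.to_comp).of_eq fun n => ?_⟩
  obtain ⟨b, hb, hb2⟩ := H (I n) (hI n)
  rw [Part.eq_some_iff.2 hb]
  congr 1
  rw [Bool.eq_iff_iff, hb2, hyes, decide_eq_true_iff]

section Instances

variable {k m c : ℕ} {d : Fin k}

/-- The instance that asks for a trace which has an event satisfying `ψ` and, in combination with
any second trace, none satisfying `χ`. -/
noncomputable def TimeDistance.existsForallInstance (D : TimeDistance d m c)
    (ψ χ : Past (Fin k)) : Instance where
  nProps := k
  nLocs := 1
  nClocks := m
  model := D.model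
  spec := existsForall (specBody D.formula ψ χ)
  closed := freeVars_existsForall _ (vars_specBody D.vars_formula ψ χ)
  fresh := by simp [existsForall, Formula.boundVars]

/-- The instance that asks for the opposite. -/
noncomputable def TimeDistance.forallExistsInstance (D : TimeDistance d m c)
    (ψ χ : Past (Fin k)) : Instance where
  nProps := k
  nLocs := 1
  nClocks := m
  model := D.model
  spec := forallExists (specBody D.formula ψ χ)
  closed := freeVars_forallExists _ (vars_specBody D.vars_formula ψ χ)
  fresh := by simp [forallExists, Formula.boundVars]

theorem TimeDistance.yes_existsForallInstance (D : TimeDistance d m c) (ψ χ : Past (Fin k)) :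
    (D.existsForallInstance ψ χ).Yes ↔ ∃ ρ ∈ D.model.language, ∀ ρ' ∈ D.model.language,
      (∃ t, Active ![ρ, ρ'] t ∧ ψ.Sat ![ρ, ρ'] (D.dist ![ρ, ρ']) t) ∧
      ∀ t, Active ![ρ, ρ'] t → ¬ χ.Sat ![ρ, ρ'] (D.dist ![ρ, ρ']) t := by
  refine (satisfies_existsForall _).trans ?_
  exact exists_congr fun ρ => and_congr_right fun _ => forall₂_congr fun ρ' _ =>
    holds_specBody _ (D.exact_formula _) (D.holds_formula _) ψ χ

theorem TimeDistance.yes_forallExistsInstance (D : TimeDistance d m c) (ψ χ : Past (Fin k)) :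
    (D.forallExistsInstance ψ χ).Yes ↔ ¬ (D.existsForallInstance ψ χ).Yes :=
  satisfies_forallExists _ fun _ => exact_specBody (D.exact_formula _) ψ χ

theorem TimeDistance.isDeterministic_existsForall (D : TimeDistance d m c) (ψ χ : Past (Fin k)) :
    (existsForall (specBody D.formula ψ χ)).IsDeterministic c :=
  Formula.isDeterministic_of_past rfl D.automaton ψ χ id fun w =>
    holds_specBody w (D.exact_formula _) (D.holds_formula w) ψ χ

theorem TimeDistance.isDeterministic_forallExists (D : TimeDistance d m c) (ψ χ : Past (Fin k)) :
    (forallExists (specBody D.formula ψ χ)).IsDeterministic c :=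
  Formula.isDeterministic_of_past rfl D.automaton ψ χ Not fun w =>
    (QF.holds_neg (exact_specBody (D.exact_formula _) ψ χ) 0).trans
      (not_congr (holds_specBody w (D.exact_formula _) (D.holds_formula w) ψ χ))

theorem TimeDistance.primrec_code_instances (D : TimeDistance d m c) (ψ : Past (Fin k))
    {χ : ℕ → Past (Fin k)} (h : Primrec fun n => (χ n).code D.formula) :
    (Primrec fun n => (D.existsForallInstance ψ (χ n)).code) ∧
      Primrec fun n => (D.forallExistsInstance ψ (χ n)).code := by
  have h1 := primrec_code_specBody D.formula ψ h
  have h2 : ∀ {f : ℕ → ℕ}, Primrec f →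
      Primrec fun n => Encodable.encode ((k, 1, m), D.model.code, f n) := fun hf =>
    Primrec.encode.comp (Primrec.pair (.const _) (Primrec.pair (.const _) hf))
  constructor
  · exact h2 (Primrec₂.natPair.comp (.const 0) (Primrec₂.natPair.comp (.const 0)
      (Primrec₂.natPair.comp (.const 1) (Primrec₂.natPair.comp (.const 1)
        (Primrec₂.natPair.comp (.const 2) h1)))))
  · exact h2 (Primrec₂.natPair.comp (.const 1) (Primrec₂.natPair.comp (.const 0)
      (Primrec₂.natPair.comp (.const 0) (Primrec₂.natPair.comp (.const 1)
        (Primrec₂.natPair.comp (.const 2) (Primrec₂.natPair.comp (.const 4) h1))))))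

/-- Each way of measuring distance one yields the undecidability of both fragments, with the
numbers of clocks involved. -/
theorem undecidable_of_timeDistance (D : ∀ k, TimeDistance (Fin.last k) m c) :
    Undecidable {I | I.spec.IsExistsForall ∧ I.nClocks = m ∧ I.model.Deterministic ∧
      ((∀ k, (D k).formula.Untimed) → I.spec.Untimed) ∧ I.spec.IsDeterministic c} ∧
    Undecidable {I | I.spec.IsForallExists ∧ I.nClocks = m ∧ I.model.Deterministic ∧
      ((∀ k, (D k).formula.Untimed) → I.spec.Untimed) ∧ I.spec.IsDeterministic c} := by
  obtain ⟨Γ, Λ, _, _, _, _, M, a, g, hM⟩ := exists_machine_undecidable_halting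
  -- Each tile is encoded by a proposition of its own, and one more proposition labels marks.
  let k := Nat.card (Tile Γ Λ)
  let enc : Tile Γ Λ → Finset (Fin (k + 1)) := fun b => {(Finite.equivFin _ b).castSucc}
  have hinj : Function.Injective enc := fun b b' h =>
    (Finite.equivFin _).injective (Fin.castSucc_injective _ (Finset.singleton_injective h))
  have henc : ∀ b, Fin.last k ∉ enc b := fun b h =>
    (Fin.castSucc_lt_last _).ne' (Finset.mem_singleton.1 h)
  let tiles := (Set.finite_univ (α := Tile Γ Λ)).toFinset.toList
  have htiles : ∀ b, b ∈ tiles := fun b => by simp [tiles]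
  let dec := Function.invFun enc
  let ψ : Past (Fin (k + 1)) := tileIn dec {b | b.Halting M}
  let χ : ℕ → Past (Fin (k + 1)) := fun n =>
    defect dec M tiles (inputRun dec a ((binDigits n).reverse.map g))
  have hcode := (D k).primrec_code_instances ψ (χ := χ) (primrec_code_defect _ dec M tiles
    (primrec_code_inputRun _ dec a g (Primrec.list_reverse.comp primrec_binDigits)))
  have hyes : ∀ n, ((D k).existsForallInstance ψ (χ n)).Yes ↔
      (eval (TM0.step M) (TM0.init (a :: (binDigits n).reverse.map g))).Dom := fun n =>
    ((D k).yes_existsForallInstance _ _).trans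
      ((D k).exists_forall_iff_dom (Function.leftInverse_invFun hinj) henc htiles a _)
  constructor
  · exact undecidable_of_reduction hM (fun n => (D k).existsForallInstance ψ (χ n))
      (fun n => ⟨trivial, rfl, (D k).deterministic, fun hu => untimed_specBody (hu k) _ _,
        (D k).isDeterministic_existsForall _ _⟩) hcode.1 hyes
  · refine undecidable_of_reduction (fun h => hM (h.not.of_eq fun n => not_not))
      (fun n => (D k).forallExistsInstance ψ (χ n))
      (fun n => ⟨trivial, rfl, (D k).deterministic, fun hu => untimed_specBody (hu k) _ _,
        (D k).isDeterministic_forallExists _ _⟩) hcode.2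
      fun n => ((D k).yes_forallExistsInstance _ _).trans (not_congr (hyes n))

end Instances

end HyperMTL

theorem mainTheorem1 :
    -- model checking of the fragments `∃*∀*` and `∀*∃*`
    HyperMTL.Undecidable {I | I.spec.IsExistsForall} ∧
    HyperMTL.Undecidable {I | I.spec.IsForallExists} ∧
    -- deterministic untimed model, deterministic one-clock specification
    HyperMTL.Undecidable {I | I.spec.IsExistsForall ∧
      I.nClocks = 0 ∧ I.model.Deterministic ∧ I.spec.IsDeterministic 1} ∧
    HyperMTL.Undecidable {I | I.spec.IsForallExists ∧
      I.nClocks = 0 ∧ I.model.Deterministic ∧ I.spec.IsDeterministic 1} ∧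
    -- deterministic one-clock model, deterministic untimed specification
    HyperMTL.Undecidable {I | I.spec.IsExistsForall ∧
      I.nClocks = 1 ∧ I.model.Deterministic ∧ I.spec.Untimed ∧ I.spec.IsDeterministic 0} ∧
    HyperMTL.Undecidable {I | I.spec.IsForallExists ∧
      I.nClocks = 1 ∧ I.model.Deterministic ∧ I.spec.Untimed ∧ I.spec.IsDeterministic 0} := by
  have h1 := HyperMTL.undecidable_of_timeDistance fun k =>
    HyperMTL.TimeDistance.bySpec (Fin.last k)
  have h2 := HyperMTL.undecidable_of_timeDistance fun k =>
    HyperMTL.TimeDistance.byModel (Fin.last k)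
  have hu : ∀ k, (HyperMTL.TimeDistance.byModel (Fin.last k)).formula.Untimed := fun k =>
    ⟨trivial, trivial⟩
  exact ⟨h1.1.mono fun I hI => hI.1, h1.2.mono fun I hI => hI.1,
    h1.1.mono fun I ⟨h, hm, hd, _, hc⟩ => ⟨h, hm, hd, hc⟩,
    h1.2.mono fun I ⟨h, hm, hd, _, hc⟩ => ⟨h, hm, hd, hc⟩,
    h2.1.mono fun I ⟨h, hm, hd, hU, hc⟩ => ⟨h, hm, hd, hU hu, hc⟩,
    h2.2.mono fun I ⟨h, hm, hd, hU, hc⟩ => ⟨h, hm, hd, hU hu, hc⟩⟩
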